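/- **Setting.** Let $(X_i)_{i\ge 0}$ be i.i.d. random vectors in $\mathbb{R}^p$ whose law has support $[0,1]^p$, let $(\varepsilon_i)_{i\ge 0}$ be i.i.d. real random variables, independent of $(X_i)_i$, with $\mathbb{E}\varepsilon_0=0$ and $\mathrm{Var}(\varepsilon_0)=\sigma^2\in(0,\infty)$, let $m:\mathbb{R}^p\to\mathbb{R}$ be measurable with $\|m\|_\infty:=\sup_{x\in[0,1]^p}|m(x)|<\infty$, and let $Y_i=m(X_i)+\varepsilon_i$. The training sample is $\mathcal{D}_n=\{(X_i,Y_i):1\le i\le n\}$; $X_0$ is an unseen input. *Random Forest.* Fix $m_{try}\in\{1,\dots,p\}$ and integers $t_n\ge 1$ and, for $n\ge 2$, $1\le a_n<n$, such that $\limsup_n a_n/n<1$. A randomized CART tree is grown as follows. Draw a bag of $a_n$ of the $n$ training points uniformly without replacement. Starting from a single cell (the whole space) process the cells breadth first. For each processed cell draw uniformly a set of $m_{try}$ directions; among the cuts $\{x_j<z\},\{x_j\ge z\}$, with $j$ a drawn direction and $z$ the midpoint of two consecutive distinct $j$-th coordinates of the bagged points in the cell, make the one which maximizes the decrease of the empirical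 variance of the responses (remaining ties: smallest $j$, then smallest $z$); if there is no such cut the cell becomes a leaf. Stop when there are $t_n$ cells, or when all cells are leaves. The tree predicts at $z$ the mean of the bagged responses in the cell of $z$. For each $n$ let $T_{n,1},T_{n,2},\dots$ be trees grown with independent random choices, independent of the observations. Put $m_{n,M}(z)=\frac1M\sum_{b=1}^M T_{n,b}(z)$ and $m_{n,\infty}(z)=\lim_{M\to\infty}m_{n,M}(z)$. For $1\le i\le n$ let the out-of-bag (OOB) prediction $m^{OOB}_{n,M}(X_i)$ using $M$ trees be the average at $X_i$ of the first $M$ trees whose bag does not contain the $i$-th training point, and let $m^{OOB}_{n,\infty}(X_i)=\lim_{M\to\infty}m^{OOB}_{n,M}(X_i)$. (These limits exist almost surely.) For $M\in\mathbb{N}\cup\{\infty\}$ put $$\widehat\sigma^2_{n,M}=\frac1n\sum_{i=1}^n\big(Y_i-m^{OOB}_{n,M}(X_i)\big)^2 .$$ **Theorem.** Assume that the infinite forest is $L_2$-consistent: $\lim_{n\to\infty}\mathbb{E}[(m_{n,\infty}(X_0)-m(X_0))^2]=0$. 1. $\widehat\sigma^2_{n,M}$ is integrable for $n\ge2$, $M\ge1$,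 and $L_1$-consistent for $\sigma^2$ under the sequential limit: $\lim_{n\to\infty}\lim_{M\to\infty}\mathbb{E}\,|\widehat\sigma^2_{n,M}-\sigma^2|=0$, where the inner limit exists for every $n\ge 2$. 2. If in addition $\varepsilon_0\sim N(0,\sigma^2)$, then for all $n\ge2$ and $M\ge1$ the variables $\widehat\sigma^2_{n,M}$ and $\widehat\sigma^2_{n,\infty}$ are integrable and $$\mathbb{E}\big[\widehat\sigma^2_{n,M}-\widehat\sigma^2_{n,\infty}\big]\le\frac8M\Big(\|m\|_\infty^2+\sigma^2(1+4\log n)\Big).$$ 3. Under the conditions of 2, the finite-$M$ corrected estimator $$\widehat\sigma^2_{n,Mcorrect}=\Big|\widehat\sigma^2_{n,M}-\frac8M\Big(\big(\max_{1\le i\le n}|m^{OOB}_{n,M}(X_i)|\big)^2+\widehat\sigma^2_{n,M}(1+4\log n)\Big)\Big|$$ is integrable for $n\ge2$, $M\ge1$, and $L_1$-consistent for $\sigma^2$ in the sense of 1. Statements 1 and 3 also hold if $m^{OOB}_{n,M}(X_i)$ is replaced, in the definition of the two estimators, by the average at $X_i$ of those among the first $M$ trees whose bag does not contain the $i$-th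 training point ($0$ if there is none). -/

import Mathlib

open MeasureTheory ProbabilityTheory Filter Topology

noncomputable section

namespace RandomForest

/-! ### Randomized CART trees -/

/-- The randomness of one tree: the bag (a set of `a` of the `n` training indices, drawn without
replacement), and one set of `q` candidate directions for each cell that is processed while the
tree is grown.  Growing a tree with at most `t` leaves processes fewer than `2 * t` cells. -/
structure TreeSeed (n p a q t : ℕ) where
  bag : {s : Finset (Fin n) // s.card = a}
  dirs : Fin (2 * t) → {f : Finset (Fin p) // f.card = q}

instance (n p a q t : ℕ) : MeasurableSpace (TreeSeed n p a q t) := ⊤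

variable {n p a q t : ℕ}

/-- The mean of the responses with index in `I` (`0` if `I` is empty). -/
def mean (y : Fin n → ℝ) (I : Finset (Fin n)) : ℝ := (∑ i ∈ I, y i) / (I.card : ℝ)

/-- The within-group sum of squares of the responses with index in `I`. -/
def sumSq (y : Fin n → ℝ) (I : Finset (Fin n)) : ℝ := ∑ i ∈ I, (y i - mean y I) ^ 2

/-- The CART criterion of the cut `(j, z)` on the points with index in `I`: the decrease of the
empirical variance if the points are separated into `x_j < z` and `x_j ≥ z`. -/
def cartCriterion (x : Fin n → Fin p → ℝ) (y : Fin n → ℝ) (I : Finset (Fin n))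
    (c : Fin p ×ₗ ℝ) : ℝ :=
  (sumSq y I - sumSq y (I.filter fun i => x i (ofLex c).1 < (ofLex c).2)
    - sumSq y (I.filter fun i => (ofLex c).2 ≤ x i (ofLex c).1)) / (I.card : ℝ)

open Classical in
/-- The admissible cuts on the points with index in `I`: a direction `j` in `F`, and the midpoint
of two consecutive distinct `j`-th coordinates of these points. -/
def cuts (x : Fin n → Fin p → ℝ) (I : Finset (Fin n)) (F : Finset (Fin p)) :
    Finset (Fin p ×ₗ ℝ) :=
  ((F ×ˢ (I ×ˢ I)).filter fun c => x c.2.1 c.1 < x c.2.2 c.1 ∧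
      ∀ l ∈ I, ¬ (x c.2.1 c.1 < x l c.1 ∧ x l c.1 < x c.2.2 c.1)).image
    fun c => toLex (c.1, (x c.2.1 c.1 + x c.2.2 c.1) / 2)

open Classical in
/-- The admissible cuts that maximize the CART criterion. -/
def bestCuts (x : Fin n → Fin p → ℝ) (y : Fin n → ℝ) (I : Finset (Fin n))
    (F : Finset (Fin p)) : Finset (Fin p ×ₗ ℝ) :=
  (cuts x I F).filter fun c => ∀ d ∈ cuts x I F, cartCriterion x y I d ≤ cartCriterion x y I c

/-- The best cut; remaining ties go to the smallest direction and then to the smallest cutting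
point.  There is none if no direction in `F` separates the points. -/
def bestCut (x : Fin n → Fin p → ℝ) (y : Fin n → ℝ) (I : Finset (Fin n))
    (F : Finset (Fin p)) : Option (Fin p ×ₗ ℝ) :=
  if h : (bestCuts x y I F).Nonempty then some ((bestCuts x y I F).min' h) else none

open Classical in
/-- The indices in the bag `S` whose points lie in the cell `A`. -/
def inCell (x : Fin n → Fin p → ℝ) (S : Finset (Fin n)) (A : Set (Fin p → ℝ)) :
    Finset (Fin n) :=
  S.filter fun i => x i ∈ A

/-- Growing a tree breadth first.  The third argument is the number of cuts that may still be made,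
the fourth the queue of cells; the first cell of the queue is either cut in two, the two parts going
to the end of the queue, or becomes a leaf because its bagged points cannot be separated.  The
result is the list of the leaves. -/
def grow (x : Fin n → Fin p → ℝ) (y : Fin n → ℝ) (S : Finset (Fin n)) :
    List (Finset (Fin p)) → ℕ → List (Set (Fin p → ℝ)) → List (Set (Fin p → ℝ))
  | _, 0, Q => Q
  | _, _ + 1, [] => []
  | [], _ + 1, A :: Q => A :: Q
  | F :: Fs, k + 1, A :: Q =>
    match bestCut x y (inCell x S A) F with
    | none => A :: grow x y S Fs (k + 1) Q
    | some c => grow x y S Fs k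
        (Q ++ [{z ∈ A | z (ofLex c).1 < (ofLex c).2}, {z ∈ A | (ofLex c).2 ≤ z (ofLex c).1}])

/-- The leaves of the tree with seed `θ`: a partition into at most `t` cells. -/
def leaves (x : Fin n → Fin p → ℝ) (y : Fin n → ℝ) (θ : TreeSeed n p a q t) :
    List (Set (Fin p → ℝ)) :=
  grow x y θ.bag (List.ofFn fun k => (θ.dirs k : Finset (Fin p))) (t - 1) [Set.univ]

/-- The prediction of the tree at `z`: the mean of the bagged responses in the leaf of `z`. -/
def treePredict (x : Fin n → Fin p → ℝ) (y : Fin n → ℝ) (θ : TreeSeed n p a q t)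
    (z : Fin p → ℝ) : ℝ :=
  ((leaves x y θ).map fun A =>
    A.indicator (fun _ => mean y (inCell x θ.bag.1 A)) z).sum

/-! ### Forests and out-of-bag predictions -/

/-- The forest with `M` trees, `m_{n,M}(z)`. -/
def forestPredict (x : Fin n → Fin p → ℝ) (y : Fin n → ℝ) (θ : ℕ → TreeSeed n p a q t)
    (M : ℕ) (z : Fin p → ℝ) : ℝ :=
  (∑ b ∈ Finset.range M, treePredict x y (θ b) z) / (M : ℝ)

/-- The infinite forest, `m_{n,∞}(z) = lim_{M → ∞} m_{n,M}(z)`. -/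
def forestPredictInf (x : Fin n → Fin p → ℝ) (y : Fin n → ℝ) (θ : ℕ → TreeSeed n p a q t)
    (z : Fin p → ℝ) : ℝ :=
  limUnder atTop fun M => forestPredict x y θ M z

/-- The position in the sequence of trees of the `k`-th tree (counted from `0`) that has been grown
without the `i`-th training point. -/
def oobIndex (θ : ℕ → TreeSeed n p a q t) (i : Fin n) (k : ℕ) : ℕ :=
  Nat.nth (fun b => i ∉ (θ b).bag.1) k

/-- The out-of-bag prediction at the `i`-th training point using `M` decision trees: the average
over the first `M` trees grown without this point. -/
def oobPredict (x : Fin n → Fin p → ℝ) (y : Fin n → ℝ) (θ : ℕ → TreeSeed n p a q t)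
    (M : ℕ) (i : Fin n) : ℝ :=
  (∑ k ∈ Finset.range M, treePredict x y (θ (oobIndex θ i k)) (x i)) / (M : ℝ)

/-- The infinite out-of-bag prediction, the limit of `oobPredict` as `M → ∞`. -/
def oobPredictInf (x : Fin n → Fin p → ℝ) (y : Fin n → ℝ) (θ : ℕ → TreeSeed n p a q t)
    (i : Fin n) : ℝ :=
  limUnder atTop fun M => oobPredict x y θ M i

/-- The out-of-bag prediction at the `i`-th training point in an ensemble of `M` trees in total:
the average over those of the first `M` trees that were grown without this point (`0` if there
are none). -/
def oobPredictEnsemble (x : Fin n → Fin p → ℝ) (y : Fin n → ℝ) (θ : ℕ → TreeSeed n p a q t)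
    (M : ℕ) (i : Fin n) : ℝ :=
  (∑ b ∈ (Finset.range M).filter (fun b => i ∉ (θ b).bag.1), treePredict x y (θ b) (x i)) /
    (((Finset.range M).filter fun b => i ∉ (θ b).bag.1).card : ℝ)

/-! ### Residual variance estimators -/

/-- The residual variance estimator `(1/n) ∑ (Y_i - pred_i)²`. -/
def residualVar (y pred : Fin n → ℝ) : ℝ := (1 / (n : ℝ)) * ∑ i, (y i - pred i) ^ 2

/-- The finite-`M` corrected residual variance estimator
`|σ̂² - (8/M) ((max_i |pred_i|)² + σ̂² (1 + 4 log n))|` with `σ̂² = residualVar y pred`. -/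
def residualVarCorrected (M : ℕ) (y pred : Fin n → ℝ) : ℝ :=
  |residualVar y pred - (8 / (M : ℝ)) *
    ((⨆ i, |pred i|) ^ 2 + residualVar y pred * (1 + 4 * Real.log n))|

/-- `L₁`-consistency of the integrable estimators `T n M` (`n ≥ 2`, `M ≥ 1`) for `c` under the
sequential limit `lim_{n → ∞} lim_{M → ∞}`. -/
def SeqL1Consistent {Ω : Type*} [MeasurableSpace Ω] (P : Measure Ω) (T : ℕ → ℕ → Ω → ℝ)
    (c : ℝ) : Prop :=
  (∀ n ≥ 2, ∀ M ≥ 1, Integrable (T n M) P) ∧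
    ∃ L : ℕ → ℝ,
      (∀ n ≥ 2, Tendsto (fun M => ∫ ω, |T n M ω - c| ∂P) atTop (𝓝 (L n))) ∧
      Tendsto L atTop (𝓝 0)

end RandomForest

/-- The covariates of the training sample of size `n`: the observations `1, …, n`.  (The index `0`
is kept for an unseen observation.) -/
def trainX {p : ℕ} {Ω : Type*} (X : ℕ → Ω → Fin p → ℝ) (n : ℕ) (ω : Ω) : Fin n → Fin p → ℝ :=
  fun i => X (i + 1) ω

/-- The responses of the training sample of size `n`: the observations `1, …, n`. -/
def trainY {Ω : Type*} (Y : ℕ → Ω → ℝ) (n : ℕ) (ω : Ω) : Fin n → ℝ :=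
  fun i => Y (i + 1) ω

end

noncomputable section

namespace RandomForest

variable {n p a q t : ℕ}

/-! A tree seed ranges over a finite set, so the strong law for the indicators of single seeds gives
one almost sure event on which all averages along the seed sequence converge, whatever the training
data (`ae_equidistributed`). There the infinite forest is the average `meanPredict` over all seeds,
and both out-of-bag predictions at point `i` tend to `oobMean`, the average over the seeds whose bag
avoids `i`. These limits are measurable functions of the data alone.

The heart is the comparison `sum_integral_oobMean_sub_sq_le`. Exchanging observation `i` with the
unseen one turns the out-of-bag error at `i` into the error at `X 0` of the average over bags
avoiding `i`. Expanding the squares gives double sums over pairs of bags of `E[bagError S * bagError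
S']`. Each such term is nonnegative: given the unseen point and the shared observations, the two
errors are independent copies of one statistic (`integral_bagError_mul_nonneg`). A pair is counted
for at most `n - a` indices `i`, and a fraction `(n - a) / n` of all bags avoids a given point.
Hence the mean out-of-bag error is at most `n / (n - a)` times the forest error, a factor that stays
bounded because `limsup a / n < 1`.

Consistency follows by writing the residual as `ε + (m - oobMean)`, applying the `L₁` law of large
numbers to `ε ^ 2`, and absorbing the cross term with Young's inequality
(`tendsto_integral_abs_residualVar_sub`). The inner limit in `M` is dominated convergence: tree
predictions are bounded by the largest absolute response. The correction carries a factor `8 / M`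
and disappears in that limit.

For the finite-`M` bias, fix the data. The deviations of the selected trees from their mean, summed
until the `M`-th selection, form a stopped martingale, and a Wald-type second moment bound gives
excess error at most `‖y‖ ^ 2 / M` (`integral_sub_selectedAvg_sq_le`). It remains to bound `E‖Y‖ ^
2` for Gaussian errors, which an exponential moment of `ε ^ 2` does with a `log n`
(`integral_norm_trainY_sq_le`). -/

/-- A seed is a pair of a bag and a list of sets of directions. -/
def seedEquiv (n p a q t : ℕ) : TreeSeed n p a q t ≃
    {s : Finset (Fin n) // s.card = a} × (Fin (2 * t) → {f : Finset (Fin p) // f.card = q}) where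
  toFun θ := (θ.bag, θ.dirs)
  invFun u := ⟨u.1, u.2⟩
  left_inv _ := rfl
  right_inv _ := rfl

instance : Fintype (TreeSeed n p a q t) := Fintype.ofEquiv _ (seedEquiv n p a q t).symm

instance : MeasurableSingletonClass (TreeSeed n p a q t) := ⟨fun _ => trivial⟩

instance : DiscreteMeasurableSpace (TreeSeed n p a q t) := ⟨fun _ => trivial⟩

/-! ### Leaves form a partition -/

/-- A cut replaces a cell by two complementary parts, so the number of listed cells containing `z`
is invariant. Counting with multiplicity replaces any bookkeeping of disjointness. -/
lemma grow_sum_indicator_one (x : Fin n → Fin p → ℝ) (y : Fin n → ℝ) (S : Finset (Fin n))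
    (z : Fin p → ℝ) (Fs : List (Finset (Fin p))) (k : ℕ) (Q : List (Set (Fin p → ℝ))) :
    ((grow x y S Fs k Q).map fun A => A.indicator (fun _ => (1 : ℝ)) z).sum =
      (Q.map fun A => A.indicator (fun _ => (1 : ℝ)) z).sum := by
  induction Fs generalizing k Q with
  | nil => cases k <;> cases Q <;> simp [grow]
  | cons F Fs ih =>
    cases k with
    | zero => simp [grow]
    | succ k =>
      cases Q with
      | nil => simp [grow]
      | cons A Q =>
        rw [grow]
        cases h : bestCut x y (inCell x S A) F with
        | none => simp [ih]
        | some c =>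
          simp only [ih, List.map_append, List.map_cons, List.map_nil, List.sum_append,
            List.sum_cons, List.sum_nil, add_zero]
          rw [add_comm]
          congr 1
          by_cases hz : z ∈ A <;> by_cases hc : z (ofLex c).1 < (ofLex c).2 <;>
            simp [Set.indicator, hz, hc, not_le.2, not_lt.1]

lemma leaves_sum_indicator_one (x : Fin n → Fin p → ℝ) (y : Fin n → ℝ) (θ : TreeSeed n p a q t)
    (z : Fin p → ℝ) :
    ((leaves x y θ).map fun A => A.indicator (fun _ => (1 : ℝ)) z).sum = 1 := by
  rw [leaves, grow_sum_indicator_one]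
  simp

lemma abs_mean_le {y : Fin n → ℝ} {K : ℝ} (hK : 0 ≤ K) (hy : ∀ i, |y i| ≤ K)
    (I : Finset (Fin n)) : |mean y I| ≤ K := by
  rw [mean, abs_div, Nat.abs_cast]
  refine div_le_of_le_mul₀ (Nat.cast_nonneg _) hK ?_
  calc |∑ i ∈ I, y i| ≤ ∑ i ∈ I, |y i| := Finset.abs_sum_le_sum_abs _ _
    _ ≤ ∑ i ∈ I, K := Finset.sum_le_sum fun i _ => hy i
    _ = K * I.card := by simp [mul_comm]

lemma abs_list_sum_indicator_le {α : Type*} {K : ℝ} (g : Set α → ℝ) (hg : ∀ A, |g A| ≤ K)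
    (z : α) (Q : List (Set α)) :
    |(Q.map fun A => A.indicator (fun _ => g A) z).sum| ≤
      K * (Q.map fun A => A.indicator (fun _ => (1 : ℝ)) z).sum := by
  induction Q with
  | nil => simp
  | cons A Q ih =>
    simp only [List.map_cons, List.sum_cons, mul_add]
    refine (abs_add_le _ _).trans (add_le_add ?_ ih)
    by_cases hz : z ∈ A <;> simp [hz, hg]

/-- A tree predicts a value between the extreme responses. -/
lemma abs_treePredict_le (x : Fin n → Fin p → ℝ) (y : Fin n → ℝ) (θ : TreeSeed n p a q t)
    (z : Fin p → ℝ) : |treePredict x y θ z| ≤ ‖y‖ := by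
  have h := abs_list_sum_indicator_le (fun A => mean y (inCell x θ.bag.1 A))
    (fun A => abs_mean_le (norm_nonneg y) (fun i => norm_le_pi_norm y i) _) z (leaves x y θ)
  rwa [leaves_sum_indicator_one, mul_one] at h

/-! ### Relabelling the training points -/

section Relabel

variable {k : ℕ} (τ : Fin k ↪ Fin n) (x : Fin n → Fin p → ℝ) (y : Fin n → ℝ)

lemma mean_map (I : Finset (Fin k)) : mean y (I.map τ) = mean (y ∘ τ) I := by
  simp [mean]

lemma sumSq_map (I : Finset (Fin k)) : sumSq y (I.map τ) = sumSq (y ∘ τ) I := by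
  simp [sumSq, mean_map]

lemma cartCriterion_map (I : Finset (Fin k)) (c : Fin p ×ₗ ℝ) :
    cartCriterion x y (I.map τ) c = cartCriterion (x ∘ τ) (y ∘ τ) I c := by
  simp [cartCriterion, Finset.filter_map, sumSq_map, Function.comp_def]

lemma mem_cuts {I : Finset (Fin n)} {F : Finset (Fin p)} {c : Fin p ×ₗ ℝ} :
    c ∈ cuts x I F ↔ ∃ j ∈ F, ∃ k ∈ I, ∃ l ∈ I, (x k j < x l j ∧
      ∀ i ∈ I, ¬ (x k j < x i j ∧ x i j < x l j)) ∧ toLex (j, (x k j + x l j) / 2) = c := by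
  simp only [cuts, Finset.mem_image, Finset.mem_filter, Finset.mem_product, Prod.exists]
  constructor
  · rintro ⟨j, k, l, ⟨⟨hj, hk, hl⟩, h⟩, rfl⟩
    exact ⟨j, hj, k, hk, l, hl, h, rfl⟩
  · rintro ⟨j, hj, k, hk, l, hl, h, rfl⟩
    exact ⟨j, k, l, ⟨⟨hj, hk, hl⟩, h⟩, rfl⟩

lemma cuts_map (I : Finset (Fin k)) (F : Finset (Fin p)) :
    cuts x (I.map τ) F = cuts (x ∘ τ) I F := by
  ext c
  simp [mem_cuts]

/-- Ties are resolved by direction and cutting point, never by the labels of the points, so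
relabelling cannot alter the choice. -/
lemma bestCut_map (I : Finset (Fin k)) (F : Finset (Fin p)) :
    bestCut x y (I.map τ) F = bestCut (x ∘ τ) (y ∘ τ) I F := by
  have h : bestCuts x y (I.map τ) F = bestCuts (x ∘ τ) (y ∘ τ) I F := by
    simp only [bestCuts, cuts_map, cartCriterion_map]
  simp only [bestCut, h]

lemma inCell_map (S : Finset (Fin k)) (A : Set (Fin p → ℝ)) :
    inCell x (S.map τ) A = (inCell (x ∘ τ) S A).map τ := by
  simp [inCell, Finset.filter_map, Function.comp_def]

lemma grow_map (S : Finset (Fin k)) (Fs : List (Finset (Fin p))) (r : ℕ)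
    (Q : List (Set (Fin p → ℝ))) :
    grow x y (S.map τ) Fs r Q = grow (x ∘ τ) (y ∘ τ) S Fs r Q := by
  induction Fs generalizing r Q with
  | nil => cases r <;> cases Q <;> simp [grow]
  | cons F Fs ih =>
    cases r with
    | zero => simp [grow]
    | succ r =>
      cases Q with
      | nil => simp [grow]
      | cons A Q => simp only [grow, inCell_map, bestCut_map, ih]

/-- A tree depends on the bagged training points only, and not on how they are labelled. -/
lemma treePredict_map (S : {s : Finset (Fin n) // s.card = a})
    (U : {s : Finset (Fin k) // s.card = a}) (h : U.1.map τ = S.1)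
    (d : Fin (2 * t) → {f : Finset (Fin p) // f.card = q}) (z : Fin p → ℝ) :
    treePredict x y (⟨S, d⟩ : TreeSeed n p a q t) z =
      treePredict (x ∘ τ) (y ∘ τ) (⟨U, d⟩ : TreeSeed k p a q t) z := by
  simp only [treePredict, leaves, ← h, grow_map, inCell_map, mean_map]

end Relabel

/-! ### Measurability of trees -/

/-- Serves every random choice among countably many options: the cut made, the content of a cell,
the seed, the position of a tree. The pieces may overlap, which allows one cut to have several
names. -/
lemma measurable_of_countable_cover {ι δ β : Type*} [Countable ι] [MeasurableSpace δ]
    [MeasurableSpace β] {f : δ → β} (E : ι → δ → Prop) (g : ι → δ → β)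
    (hE : ∀ i, Measurable (E i)) (hg : ∀ i, Measurable (g i)) (hcover : ∀ d, ∃ i, E i d)
    (hf : ∀ i d, E i d → f d = g i d) : Measurable f := by
  intro s hs
  have : f ⁻¹' s = ⋃ i, {d | E i d} ∩ g i ⁻¹' s := by
    ext d
    simp only [Set.mem_preimage, Set.mem_iUnion, Set.mem_inter_iff, Set.mem_ofPred_eq]
    constructor
    · intro h
      obtain ⟨i, hi⟩ := hcover d
      exact ⟨i, hi, by rwa [← hf i d hi]⟩
    · rintro ⟨i, hi, h⟩
      rwa [hf i d hi]
  rw [this]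
  exact MeasurableSet.iUnion fun i => (measurableSet_setOfPred.2 (hE i)).inter (hg i hs)

section Measurability

variable {δ : Type*} [MeasurableSpace δ] {x : δ → Fin n → Fin p → ℝ} {y : δ → Fin n → ℝ}

lemma measurable_ite_prop {P : δ → Prop} [∀ d, Decidable (P d)] (hP : Measurable P) {f g : δ → ℝ}
    (hf : Measurable f) (hg : Measurable g) : Measurable fun d => if P d then f d else g d :=
  Measurable.ite (measurableSet_setOfPred.2 hP) hf hg

lemma measurable_mean_filter (hy : Measurable y) (I : Finset (Fin n)) (P : δ → Fin n → Prop)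
    [∀ d, DecidablePred (P d)] (hP : ∀ i, Measurable fun d => P d i) :
    Measurable fun d => mean (y d) (I.filter (P d)) := by
  simp only [mean, Finset.sum_filter, Finset.card_filter, Nat.cast_sum, Nat.cast_ite,
    Nat.cast_one, Nat.cast_zero]
  refine Measurable.div ?_ ?_
  · exact Finset.measurable_sum _ fun i _ =>
      measurable_ite_prop (hP i) (measurable_pi_iff.1 hy i) measurable_const
  · exact Finset.measurable_sum _ fun i _ =>
      measurable_ite_prop (hP i) measurable_const measurable_const

lemma measurable_sumSq_filter (hy : Measurable y) (I : Finset (Fin n)) (P : δ → Fin n → Prop)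
    [∀ d, DecidablePred (P d)] (hP : ∀ i, Measurable fun d => P d i) :
    Measurable fun d => sumSq (y d) (I.filter (P d)) := by
  have h := measurable_mean_filter hy I P hP
  simp only [sumSq]
  simp only [Finset.sum_filter (s := I)]
  exact Finset.measurable_sum _ fun i _ => measurable_ite_prop (hP i)
    (((measurable_pi_iff.1 hy i).sub h).pow_const 2) measurable_const

lemma measurable_sumSq (hy : Measurable y) (I : Finset (Fin n)) :
    Measurable fun d => sumSq (y d) I := by
  simpa using measurable_sumSq_filter hy I (fun _ _ => True) fun _ => measurable_const

lemma measurable_coord (hx : Measurable x) (i : Fin n) (j : Fin p) :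
    Measurable fun d => x d i j :=
  measurable_pi_iff.1 (measurable_pi_iff.1 hx i) j

lemma measurable_prop_lt {f g : δ → ℝ} (hf : Measurable f) (hg : Measurable g) :
    Measurable fun d => f d < g d :=
  measurableSet_setOfPred.1 (measurableSet_lt hf hg)

lemma measurable_prop_le {f g : δ → ℝ} (hf : Measurable f) (hg : Measurable g) :
    Measurable fun d => f d ≤ g d :=
  measurableSet_setOfPred.1 (measurableSet_le hf hg)

lemma measurable_prop_eq {f g : δ → ℝ} (hf : Measurable f) (hg : Measurable g) :
    Measurable fun d => f d = g d :=
  measurableSet_setOfPred.1 (measurableSet_eq_fun hf hg)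

lemma measurable_cartCriterion (hx : Measurable x) (hy : Measurable y) (I : Finset (Fin n))
    (j : Fin p) {v : δ → ℝ} (hv : Measurable v) :
    Measurable fun d => cartCriterion (x d) (y d) I (toLex (j, v d)) := by
  simp only [cartCriterion, ofLex_toLex]
  refine ((measurable_sumSq hy I).sub ?_ |>.sub ?_).div_const _
  · exact measurable_sumSq_filter hy I _ fun i => measurable_prop_lt (measurable_coord hx i j) hv
  · exact measurable_sumSq_filter hy I _ fun i => measurable_prop_le hv (measurable_coord hx i j)

/-- The `k`-th and the `l`-th point define an admissible cut in direction `j`. -/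
def ValidCut (x : Fin n → Fin p → ℝ) (I : Finset (Fin n)) (F : Finset (Fin p))
    (u : Fin p × Fin n × Fin n) : Prop :=
  u.1 ∈ F ∧ u.2.1 ∈ I ∧ u.2.2 ∈ I ∧ x u.2.1 u.1 < x u.2.2 u.1 ∧
    ∀ i, i ∈ I → ¬ (x u.2.1 u.1 < x i u.1 ∧ x i u.1 < x u.2.2 u.1)

/-- The midpoint of the `j`-th coordinates of two points. -/
def cutPoint (x : Fin n → Fin p → ℝ) (u : Fin p × Fin n × Fin n) : ℝ :=
  (x u.2.1 u.1 + x u.2.2 u.1) / 2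

/-- Cuts vary with the data in an uncountable set, but triples (direction, point, point) name them
from a fixed finite set. Quantifiers over cuts thus become finite ones over measurable events. -/
lemma mem_cuts_iff_validCut {x : Fin n → Fin p → ℝ} {I : Finset (Fin n)} {F : Finset (Fin p)}
    {c : Fin p ×ₗ ℝ} :
    c ∈ cuts x I F ↔ ∃ u, ValidCut x I F u ∧ toLex (u.1, cutPoint x u) = c := by
  rw [mem_cuts]
  constructor
  · rintro ⟨j, hj, k, hk, l, hl, h, rfl⟩
    exact ⟨(j, k, l), ⟨hj, hk, hl, h.1, h.2⟩, rfl⟩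
  · rintro ⟨⟨j, k, l⟩, ⟨hj, hk, hl, h1, h2⟩, rfl⟩
    exact ⟨j, hj, k, hk, l, hl, ⟨h1, h2⟩, rfl⟩

lemma measurable_validCut (hx : Measurable x) (I : Finset (Fin n)) (F : Finset (Fin p))
    (u : Fin p × Fin n × Fin n) : Measurable fun d => ValidCut (x d) I F u := by
  have hc := fun i => measurable_coord hx i u.1
  refine measurable_const.and (measurable_const.and (measurable_const.and
    ((measurable_prop_lt (hc _) (hc _)).and (Measurable.forall fun i => ?_))))
  exact measurable_const.imp ((measurable_prop_lt (hc _) (hc _)).and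
    (measurable_prop_lt (hc _) (hc _))).not

lemma measurable_cutPoint (hx : Measurable x) (u : Fin p × Fin n × Fin n) :
    Measurable fun d => cutPoint (x d) u :=
  ((measurable_coord hx _ _).add (measurable_coord hx _ _)).div_const 2

lemma bestCut_eq_some_iff {x : Fin n → Fin p → ℝ} {y : Fin n → ℝ} {I : Finset (Fin n)}
    {F : Finset (Fin p)} {c : Fin p ×ₗ ℝ} :
    bestCut x y I F = some c ↔ c ∈ bestCuts x y I F ∧ ∀ c' ∈ bestCuts x y I F, c ≤ c' := by
  unfold bestCut
  split_ifs with h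
  · rw [Option.some_inj, Finset.min'_eq_iff]
  · simp only [false_iff, not_and]
    exact fun hc => (h ⟨c, hc⟩).elim

lemma exists_eq_toLex_of_bestCut_eq_some {x : Fin n → Fin p → ℝ} {y : Fin n → ℝ}
    {I : Finset (Fin n)} {F : Finset (Fin p)} {c : Fin p ×ₗ ℝ} (h : bestCut x y I F = some c) :
    ∃ u : Fin p × Fin n × Fin n, c = toLex (u.1, cutPoint x u) := by
  have hc := (bestCut_eq_some_iff.1 h).1
  rw [bestCuts, Finset.mem_filter, mem_cuts_iff_validCut] at hc
  obtain ⟨⟨u, _, hu⟩, _⟩ := hc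
  exact ⟨u, hu.symm⟩

lemma measurable_bestCut_eq_some (hx : Measurable x) (hy : Measurable y) (I : Finset (Fin n))
    (F : Finset (Fin p)) (u : Fin p × Fin n × Fin n) :
    Measurable fun d => bestCut (x d) (y d) I F = some (toLex (u.1, cutPoint (x d) u)) := by
  simp only [bestCut_eq_some_iff, bestCuts, Finset.mem_filter, mem_cuts_iff_validCut, and_imp,
    forall_exists_index, forall_apply_eq_imp_iff₂, Prod.Lex.toLex_le_toLex, EmbeddingLike.apply_eq_iff_eq,
    Prod.mk.injEq]
  have hv := fun w => measurable_validCut hx I F w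
  have hp := fun w => measurable_cutPoint hx w
  have hcrit := fun w => measurable_cartCriterion hx hy I w.1 (hp w)
  have hmax : ∀ w, Measurable fun d => ∀ w', ValidCut (x d) I F w' →
      cartCriterion (x d) (y d) I (toLex (w'.1, cutPoint (x d) w')) ≤
        cartCriterion (x d) (y d) I (toLex (w.1, cutPoint (x d) w)) := fun w =>
    Measurable.forall fun w' => (hv w').imp (measurable_prop_le (hcrit w') (hcrit w))
  refine ((Measurable.exists fun w => (hv w).and (measurable_const.and
    (measurable_prop_eq (hp w) (hp u)))).and (hmax u)).and (Measurable.forall fun w => ?_)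
  exact (hv w).imp ((hmax w).imp (measurable_const.or
    (measurable_const.and (measurable_prop_le (hp u) (hp w)))))

/-- A random cell with a measurable graph. -/
def MeasurableCell (A : δ → Set (Fin p → ℝ)) : Prop :=
  MeasurableSet {u : δ × (Fin p → ℝ) | u.2 ∈ A u.1}

lemma MeasurableCell.measurable_mem {A : δ → Set (Fin p → ℝ)} (hA : MeasurableCell A)
    {z : δ → Fin p → ℝ} (hz : Measurable z) : Measurable fun d => z d ∈ A d :=
  measurableSet_setOfPred.1 ((measurable_id.prodMk hz) hA)

lemma measurable_inCell_eq (hx : Measurable x) (S : Finset (Fin n)) {A : δ → Set (Fin p → ℝ)}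
    (hA : MeasurableCell A) (I : Finset (Fin n)) :
    Measurable fun d => inCell (x d) S (A d) = I := by
  simp only [Finset.ext_iff, inCell, Finset.mem_filter]
  exact Measurable.forall fun i => (measurable_const.and
    (hA.measurable_mem (measurable_pi_iff.1 hx i))).iff measurable_const

lemma measurable_bestCut_inCell_eq_some (hx : Measurable x) (hy : Measurable y)
    (S : Finset (Fin n)) {A : δ → Set (Fin p → ℝ)} (hA : MeasurableCell A)
    (F : Finset (Fin p)) (u : Fin p × Fin n × Fin n) :
    Measurable fun d => bestCut (x d) (y d) (inCell (x d) S (A d)) F =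
      some (toLex (u.1, cutPoint (x d) u)) :=
  measurable_of_countable_cover (fun (I : Finset (Fin n)) d => inCell (x d) S (A d) = I)
    (fun I d => bestCut (x d) (y d) I F = some (toLex (u.1, cutPoint (x d) u)))
    (measurable_inCell_eq hx S hA) (fun I => measurable_bestCut_eq_some hx hy I F u)
    (fun d => ⟨_, rfl⟩) fun I d h => by rw [h]

/-- Cells depend on the data through the cutting points, so the queue consists of set-valued
functions with measurable graph, a property both parts of a cut inherit. The induction splits the
data space according to a triple naming the best cut. -/
lemma measurable_grow_sum (hx : Measurable x) (hy : Measurable y) {z : δ → Fin p → ℝ}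
    (hz : Measurable z) (S : Finset (Fin n)) (Fs : List (Finset (Fin p))) (k : ℕ)
    (Q : List (δ → Set (Fin p → ℝ))) (hQ : ∀ A ∈ Q, MeasurableCell A) :
    Measurable fun d => ((grow (x d) (y d) S Fs k (Q.map fun A => A d)).map fun A =>
      A.indicator (fun _ => mean (y d) (inCell (x d) S A)) (z d)).sum := by
  have hcell : ∀ A : δ → Set (Fin p → ℝ), MeasurableCell A → Measurable fun d =>
      (A d).indicator (fun _ => mean (y d) (inCell (x d) S (A d))) (z d) := by
    intro A hA
    classical
    simp only [Set.indicator_apply, inCell]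
    exact measurable_ite_prop (hA.measurable_mem hz) (measurable_mean_filter hy S _ fun i =>
      hA.measurable_mem (measurable_pi_iff.1 hx i)) measurable_const
  have hlist : ∀ Q : List (δ → Set (Fin p → ℝ)), (∀ A ∈ Q, MeasurableCell A) →
      Measurable fun d => ((Q.map fun A => A d).map fun A =>
        A.indicator (fun _ => mean (y d) (inCell (x d) S A)) (z d)).sum := by
    intro Q hQ
    induction Q with
    | nil => simp
    | cons A Q ih =>
      simp only [List.map_cons, List.sum_cons]
      exact (hcell A (hQ A (by simp))).add (ih fun B hB => hQ B (by simp [hB]))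
  induction Fs generalizing k Q with
  | nil =>
    convert hlist Q hQ using 4 with d
    cases k <;> cases Q <;> simp [grow]
  | cons F Fs ih =>
    cases k with
    | zero => simpa only [grow] using hlist Q hQ
    | succ k =>
      cases Q with
      | nil => simp [grow]
      | cons A Q =>
        have hA : MeasurableCell A := hQ A (by simp)
        have hQ' : ∀ B ∈ Q, MeasurableCell B := fun B hB => hQ B (by simp [hB])
        have hsome := fun u => measurable_bestCut_inCell_eq_some hx hy S hA F u
        -- Index `none` is the event that no triple names the best cut, so that the cell becomes a
        -- leaf; `some u` is the event that `u` names it.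
        refine measurable_of_countable_cover
          (fun (o : Option (Fin p × Fin n × Fin n)) d => o.elim
            (¬ ∃ u, bestCut (x d) (y d) (inCell (x d) S (A d)) F =
              some (toLex (u.1, cutPoint (x d) u)))
            fun u => bestCut (x d) (y d) (inCell (x d) S (A d)) F =
              some (toLex (u.1, cutPoint (x d) u)))
          (fun o d => o.elim
            ((A d).indicator (fun _ => mean (y d) (inCell (x d) S (A d))) (z d) +
              ((grow (x d) (y d) S Fs (k + 1) (Q.map fun A => A d)).map fun A =>
                A.indicator (fun _ => mean (y d) (inCell (x d) S A)) (z d)).sum)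
            fun u => ((grow (x d) (y d) S Fs k ((Q ++
                [fun d => {z ∈ A d | z u.1 < cutPoint (x d) u},
                  fun d => {z ∈ A d | cutPoint (x d) u ≤ z u.1}]).map fun A => A d)).map fun A =>
                A.indicator (fun _ => mean (y d) (inCell (x d) S A)) (z d)).sum) ?_ ?_ ?_ ?_
        · rintro (_ | u)
          · exact (Measurable.exists hsome).not
          · exact hsome u
        · rintro (_ | u)
          · exact (hcell A hA).add (ih (k + 1) Q hQ')
          · refine ih k _ fun B hB => ?_
            have hv : Measurable fun w : δ × (Fin p → ℝ) => cutPoint (x w.1) u :=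
              (measurable_cutPoint hx u).comp measurable_fst
            have hw : Measurable fun w : δ × (Fin p → ℝ) => w.2 u.1 :=
              (measurable_pi_apply _).comp measurable_snd
            simp only [List.mem_append, List.mem_cons, List.not_mem_nil, or_false] at hB
            obtain hB | rfl | rfl := hB
            · exact hQ' B hB
            · exact hA.inter (measurableSet_lt hw hv)
            · exact hA.inter (measurableSet_le hv hw)
        · intro d
          by_cases h : ∃ u : Fin p × Fin n × Fin n,
              bestCut (x d) (y d) (inCell (x d) S (A d)) F =
                some (toLex (u.1, cutPoint (x d) u))
          · exact ⟨some h.choose, h.choose_spec⟩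
          · exact ⟨none, h⟩
        · rintro (_ | u) d h
          · have h' : bestCut (x d) (y d) (inCell (x d) S (A d)) F = none := by
              by_contra hne
              obtain ⟨c, hc⟩ := Option.ne_none_iff_exists'.1 hne
              obtain ⟨u, rfl⟩ := exists_eq_toLex_of_bestCut_eq_some hc
              exact h ⟨u, hc⟩
            simp only [List.map_cons, grow, h', Option.elim, List.sum_cons]
          · simp only [Option.elim] at h
            simp only [List.map_cons, grow, h, Option.elim, List.map_append, List.map_nil,
              ofLex_toLex]

lemma measurable_treePredict (hx : Measurable x) (hy : Measurable y) {z : δ → Fin p → ℝ}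
    (hz : Measurable z) (θ : TreeSeed n p a q t) :
    Measurable fun d => treePredict (x d) (y d) θ (z d) :=
  measurable_grow_sum hx hy hz θ.bag.1 _ (t - 1) [fun _ => Set.univ] (by
    simp [MeasurableCell])

lemma measurable_treePredict_random (hx : Measurable x) (hy : Measurable y) {z : δ → Fin p → ℝ}
    (hz : Measurable z) {θ : δ → TreeSeed n p a q t} (hθ : Measurable θ) :
    Measurable fun d => treePredict (x d) (y d) (θ d) (z d) :=
  measurable_of_countable_cover (fun s d => θ d = s) (fun s d => treePredict (x d) (y d) s (z d))
    (fun s => measurableSet_setOfPred.1 (hθ (measurableSet_singleton s)))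
    (fun s => measurable_treePredict hx hy hz s) (fun _ => ⟨_, rfl⟩) fun s d h => by rw [h]

end Measurability

/-! ### Averages along sequences in a finite type -/

section Sequences

variable {S : Type*} [Fintype S] {θ : ℕ → S}

/-- All averages along the sequence `θ` converge to averages with respect to the uniform
distribution. -/
def Equidistributed (θ : ℕ → S) : Prop :=
  ∀ f : S → ℝ, Tendsto (fun M : ℕ => (∑ b ∈ Finset.range M, f (θ b)) / (M : ℝ)) atTop
    (𝓝 ((∑ s, f s) / Fintype.card S))

open Classical in
/-- The average of `f` over the elements that satisfy `r`. -/
def condAvg (r : S → Prop) (f : S → ℝ) : ℝ :=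
  (∑ s with r s, f s) / ((Finset.univ.filter r).card : ℝ)

open Classical in
-- A quotient of two plain averages, of `f` times the indicator of `r` and of the indicator itself;
-- the second limit is positive because some element satisfies `r`.
lemma Equidistributed.tendsto_filter (h : Equidistributed θ) {r : S → Prop} (hr : ∃ s, r s)
    (f : S → ℝ) :
    Tendsto (fun M : ℕ => (∑ b ∈ (Finset.range M).filter (fun b => r (θ b)), f (θ b)) /
      (((Finset.range M).filter fun b => r (θ b)).card : ℝ)) atTop (𝓝 (condAvg r f)) := by
  have h1 := h fun s => if r s then f s else 0
  have h2 := h fun s => if r s then 1 else 0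
  simp only [← Finset.sum_filter] at h1 h2
  simp only [Finset.sum_const, nsmul_eq_mul, mul_one] at h2
  obtain ⟨s, hs⟩ := hr
  have hpos : (0 : ℝ) < (Finset.univ.filter r).card := by
    exact_mod_cast Finset.card_pos.2 ⟨s, by simpa using hs⟩
  have hcard : (0 : ℝ) < Fintype.card S := by
    exact_mod_cast Fintype.card_pos_iff.2 ⟨s⟩
  have h3 := h1.div h2 (div_pos hpos hcard).ne'
  rw [div_div_div_cancel_right₀ hcard.ne'] at h3
  refine h3.congr' ?_
  filter_upwards [eventually_gt_atTop 0] with M hM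
  have : (M : ℝ) ≠ 0 := by positivity
  simp only [Pi.div_apply]
  rw [div_div_div_cancel_right₀ this]

/-- Finitely many selections would have limiting frequency zero, while equidistribution gives them a
positive one. -/
lemma Equidistributed.infinite (h : Equidistributed θ) {r : S → Prop} (hr : ∃ s, r s) :
    {b | r (θ b)}.Infinite := by
  classical
  intro hfin
  have h2 := h fun s => if r s then 1 else 0
  simp only [← Finset.sum_filter, Finset.sum_const, nsmul_eq_mul, mul_one] at h2
  obtain ⟨s, hs⟩ := hr
  have hpos : (0 : ℝ) < (Finset.univ.filter r).card := by
    exact_mod_cast Finset.card_pos.2 ⟨s, by simpa using hs⟩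
  have hcard : (0 : ℝ) < Fintype.card S := by
    exact_mod_cast Fintype.card_pos_iff.2 ⟨s⟩
  have h0 : Tendsto (fun M : ℕ => (((Finset.range M).filter fun b => r (θ b)).card : ℝ) / M)
      atTop (𝓝 0) := by
    refine squeeze_zero (fun M => by positivity) (fun M => ?_)
      (tendsto_const_div_atTop_nhds_zero_nat (hfin.toFinset.card : ℝ))
    gcongr
    intro b hb
    simpa using (Finset.mem_filter.1 hb).2
  exact (div_pos hpos hcard).ne' (tendsto_nhds_unique h2 h0)

lemma sum_range_nth {r : ℕ → Prop} [DecidablePred r] (hr : {b | r b}.Infinite) (g : ℕ → ℝ)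
    (M : ℕ) :
    ∑ k ∈ Finset.range M, g (Nat.nth r k) =
      ∑ b ∈ (Finset.range (Nat.nth r M)).filter r, g b := by
  induction M with
  | zero =>
    rw [Finset.range_zero, Finset.sum_empty, Finset.filter_false_of_mem, Finset.sum_empty]
    intro b hb hrb
    have h := (Nat.isLeast_nth_of_infinite hr 0).2 ⟨hrb, by simp⟩
    exact absurd (Finset.mem_range.1 hb) (not_lt.2 h)
  | succ M ih =>
    rw [Finset.sum_range_succ, ih, Nat.filter_range_nth_eq_insert_of_infinite hr,
      Finset.sum_insert (by simp), add_comm]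

lemma card_filter_range_nth {r : ℕ → Prop} [DecidablePred r] (hr : {b | r b}.Infinite) (M : ℕ) :
    ((Finset.range (Nat.nth r M)).filter r).card = M := by
  rw [← Nat.count_eq_card_filter_range, Nat.count_nth_of_infinite hr]

/-- This is `tendsto_filter` along a subsequence: exactly `M` selected positions lie below `Nat.nth
_ M`. -/
lemma Equidistributed.tendsto_nth (h : Equidistributed θ) {r : S → Prop} (hr : ∃ s, r s)
    (f : S → ℝ) :
    Tendsto (fun M : ℕ => (∑ k ∈ Finset.range M, f (θ (Nat.nth (fun b => r (θ b)) k))) / (M : ℝ))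
      atTop (𝓝 (condAvg r f)) := by
  classical
  have hinf := h.infinite hr
  refine ((h.tendsto_filter hr f).comp (Nat.nth_strictMono hinf).tendsto_atTop).congr fun M => ?_
  simp only [Function.comp_apply]
  rw [sum_range_nth hinf (fun b => f (θ b)), card_filter_range_nth hinf]

end Sequences

/-- The average of the predictions of all trees. -/
def meanPredict (a q t : ℕ) (x : Fin n → Fin p → ℝ) (y : Fin n → ℝ) (z : Fin p → ℝ) : ℝ :=
  (∑ s : TreeSeed n p a q t, treePredict x y s z) / Fintype.card (TreeSeed n p a q t)

/-- The average of the predictions at the `i`-th training point of all trees grown without this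
point. -/
def oobMean (a q t : ℕ) (x : Fin n → Fin p → ℝ) (y : Fin n → ℝ) (i : Fin n) : ℝ :=
  condAvg (fun s : TreeSeed n p a q t => i ∉ s.bag.1) fun s => treePredict x y s (x i)

lemma Equidistributed.forestPredictInf_eq {θ : ℕ → TreeSeed n p a q t} (h : Equidistributed θ)
    (x : Fin n → Fin p → ℝ) (y : Fin n → ℝ) (z : Fin p → ℝ) :
    forestPredictInf x y θ z = meanPredict a q t x y z :=
  (h fun s => treePredict x y s z).limUnder_eq

/-- Guarantees that the conditional averages over out-of-bag seeds are not the degenerate `0 / 0`.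
-/
lemma exists_seed_notMem_bag (ha : a < n) (hq : q ≤ p) (i : Fin n) :
    ∃ s : TreeSeed n p a q t, i ∉ s.bag.1 := by
  obtain ⟨S, hS, hc⟩ := Finset.exists_subset_card_eq (s := Finset.univ.erase i) (n := a)
    (by rw [Finset.card_erase_of_mem (Finset.mem_univ i)]; simp; omega)
  obtain ⟨F, -, hF⟩ := Finset.exists_subset_card_eq (s := (Finset.univ : Finset (Fin p)))
    (n := q) (by simpa)
  exact ⟨⟨⟨S, hc⟩, fun _ => ⟨F, hF⟩⟩, fun hi => by simpa using hS hi⟩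

section Limits

variable {θ : ℕ → TreeSeed n p a q t} (h : Equidistributed θ) (ha : a < n) (hq : q ≤ p)
  (x : Fin n → Fin p → ℝ) (y : Fin n → ℝ) (i : Fin n)
include h ha hq

lemma Equidistributed.tendsto_oobPredict :
    Tendsto (fun M => oobPredict x y θ M i) atTop (𝓝 (oobMean a q t x y i)) :=
  h.tendsto_nth (exists_seed_notMem_bag ha hq i) fun s => treePredict x y s (x i)

lemma Equidistributed.oobPredictInf_eq : oobPredictInf x y θ i = oobMean a q t x y i :=
  (h.tendsto_oobPredict ha hq x y i).limUnder_eq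

lemma Equidistributed.tendsto_oobPredictEnsemble :
    Tendsto (fun M => oobPredictEnsemble x y θ M i) atTop (𝓝 (oobMean a q t x y i)) := by
  refine (h.tendsto_filter (exists_seed_notMem_bag ha hq i)
    fun s => treePredict x y s (x i)).congr fun M => ?_
  simp only [oobPredictEnsemble]
  congr!

end Limits

/-! ### Bounds on averaged predictions -/

lemma abs_sum_div_card_le {ι : Type*} (I : Finset ι) (g : ι → ℝ) {K : ℝ} (hK : 0 ≤ K)
    (hg : ∀ i ∈ I, |g i| ≤ K) : |(∑ i ∈ I, g i) / (I.card : ℝ)| ≤ K := by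
  rw [abs_div, Nat.abs_cast]
  refine div_le_of_le_mul₀ (Nat.cast_nonneg _) hK ?_
  calc |∑ i ∈ I, g i| ≤ ∑ i ∈ I, |g i| := Finset.abs_sum_le_sum_abs _ _
    _ ≤ ∑ i ∈ I, K := Finset.sum_le_sum hg
    _ = K * I.card := by simp [mul_comm]

section Bounds

variable (x : Fin n → Fin p → ℝ) (y : Fin n → ℝ)

lemma abs_oobPredict_le (θ : ℕ → TreeSeed n p a q t) (M : ℕ) (i : Fin n) :
    |oobPredict x y θ M i| ≤ ‖y‖ := by
  have h := abs_sum_div_card_le (Finset.range M)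
    (fun k => treePredict x y (θ (oobIndex θ i k)) (x i)) (norm_nonneg y)
    fun k _ => abs_treePredict_le _ _ _ _
  rwa [Finset.card_range] at h

lemma abs_oobPredictEnsemble_le (θ : ℕ → TreeSeed n p a q t) (M : ℕ) (i : Fin n) :
    |oobPredictEnsemble x y θ M i| ≤ ‖y‖ :=
  abs_sum_div_card_le _ _ (norm_nonneg y) fun _ _ => abs_treePredict_le _ _ _ _

lemma abs_oobMean_le (i : Fin n) : |oobMean a q t x y i| ≤ ‖y‖ :=
  abs_sum_div_card_le _ _ (norm_nonneg y) fun _ _ => abs_treePredict_le _ _ _ _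

end Bounds

/-! ### Measurability of averaged predictions -/

/-- The second alternative is the default value `0` of `Nat.nth` when there are too few hits. It
must be covered because measurability is needed on all of the space, not only where hits are
infinite in number. -/
lemma nth_eq_iff {r : ℕ → Prop} [DecidablePred r] (k N : ℕ) :
    Nat.nth r k = N ↔ (r N ∧ Nat.count r N = k) ∨
      (N = 0 ∧ ∀ N', ¬ (r N' ∧ Nat.count r N' = k)) := by
  by_cases hk : ∀ hf : (Set.ofPred r).Finite, k < hf.toFinset.card
  · have h1 := Nat.nth_mem k hk
    have h2 := Nat.count_nth hk
    constructor
    · rintro rfl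
      exact Or.inl ⟨h1, h2⟩
    · rintro (⟨h3, h4⟩ | ⟨-, h3⟩)
      · rw [← h4, Nat.nth_count h3]
      · exact (h3 _ ⟨h1, h2⟩).elim
  · push Not at hk
    obtain ⟨hf, hk⟩ := hk
    rw [Nat.nth_of_card_le hf hk]
    have hno : ∀ N', ¬ (r N' ∧ Nat.count r N' = k) := by
      rintro N' ⟨h1, h2⟩
      obtain ⟨j, hj, hjN⟩ := Nat.exists_lt_card_finite_nth_eq hf h1
      have := Nat.count_nth (p := r) (n := j) fun _ => hj
      rw [hjN] at this
      omega
    constructor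
    · rintro rfl
      exact Or.inr ⟨rfl, hno⟩
    · rintro (h | ⟨rfl, -⟩)
      · exact (hno N h).elim
      · rfl

lemma measurable_count {δ : Type*} [MeasurableSpace δ] {r : δ → ℕ → Prop}
    [∀ d, DecidablePred (r d)] (hr : ∀ b, Measurable fun d => r d b) (N : ℕ) :
    Measurable fun d => Nat.count (r d) N := by
  induction N with
  | zero => simp
  | succ N ih =>
    simp only [Nat.count_succ]
    exact ih.add (Measurable.ite (measurableSet_setOfPred.2 (hr N)) measurable_const
      measurable_const)

lemma measurable_nth {δ : Type*} [MeasurableSpace δ] {r : δ → ℕ → Prop}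
    (hr : ∀ b, Measurable fun d => r d b) (k : ℕ) : Measurable fun d => Nat.nth (r d) k := by
  classical
  have hc : ∀ N, Measurable fun d => r d N ∧ Nat.count (r d) N = k := fun N =>
    (hr N).and (measurableSet_setOfPred.1 (measurable_count hr N (measurableSet_singleton k)))
  refine measurable_to_countable' fun N => ?_
  have : (fun d => Nat.nth (r d) k) ⁻¹' {N} = {d | (r d N ∧ Nat.count (r d) N = k) ∨
      (N = 0 ∧ ∀ N', ¬ (r d N' ∧ Nat.count (r d) N' = k))} := by
    ext d
    exact nth_eq_iff k N
  rw [this]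
  exact measurableSet_setOfPred.2 ((hc N).or (measurable_const.and
    (Measurable.forall fun N' => (hc N').not)))

section Measurability

variable {δ : Type*} [MeasurableSpace δ] {x : δ → Fin n → Fin p → ℝ} {y : δ → Fin n → ℝ}
  {θ : δ → ℕ → TreeSeed n p a q t}

lemma measurable_prop_discrete {S : Type*} [MeasurableSpace S] [DiscreteMeasurableSpace S]
    {g : δ → S} (hg : Measurable g) (r : S → Prop) : Measurable fun d => r (g d) :=
  (Measurable.of_discrete (f := r)).comp hg

lemma measurable_oobPredict (hx : Measurable x) (hy : Measurable y) (hθ : Measurable θ) (M : ℕ)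
    (i : Fin n) : Measurable fun d => oobPredict (x d) (y d) (θ d) M i := by
  have hθ' := measurable_pi_iff.1 hθ
  have hindex : ∀ k, Measurable fun d => oobIndex (θ d) i k := fun k =>
    measurable_nth (fun b => measurable_prop_discrete (hθ' b) fun s => i ∉ s.bag.1) k
  refine (Finset.measurable_sum _ fun k _ => ?_).div_const _
  refine measurable_treePredict_random hx hy (measurable_pi_iff.1 hx i)
    (θ := fun d => θ d (oobIndex (θ d) i k)) ?_
  exact measurable_of_countable_cover (fun N d => oobIndex (θ d) i k = N) (fun N d => θ d N)
    (fun N => measurable_prop_discrete (hindex k) fun N' => N' = N) hθ' (fun _ => ⟨_, rfl⟩)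
    fun N d h => by rw [h]

lemma measurable_oobPredictEnsemble (hx : Measurable x) (hy : Measurable y) (hθ : Measurable θ)
    (M : ℕ) (i : Fin n) : Measurable fun d => oobPredictEnsemble (x d) (y d) (θ d) M i := by
  have hθ' := measurable_pi_iff.1 hθ
  have hmem := fun b => measurable_prop_discrete (hθ' b) fun s => i ∉ s.bag.1
  simp only [oobPredictEnsemble, Finset.sum_filter, Finset.card_filter, Nat.cast_sum,
    Nat.cast_ite, Nat.cast_one, Nat.cast_zero]
  refine Measurable.div ?_ ?_
  · exact Finset.measurable_sum _ fun b _ => measurable_ite_prop (hmem b)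
      (measurable_treePredict_random hx hy (measurable_pi_iff.1 hx i) (hθ' b)) measurable_const
  · exact Finset.measurable_sum _ fun b _ =>
      measurable_ite_prop (hmem b) measurable_const measurable_const

lemma measurable_oobMean (hx : Measurable x) (hy : Measurable y) (i : Fin n) :
    Measurable fun d => oobMean a q t (x d) (y d) i :=
  (Finset.measurable_sum _ fun s _ =>
    measurable_treePredict hx hy (measurable_pi_iff.1 hx i) s).div_const _

end Measurability

/-! ### Independent uniform seeds -/

section Uniform

variable {Ω S : Type*} [MeasurableSpace Ω] {P : Measure Ω} [Fintype S] [MeasurableSpace S]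
  [DiscreteMeasurableSpace S] {θ : ℕ → Ω → S}

lemma integral_comp_of_map_eq_uniformOn {g : Ω → S} (hg : Measurable g)
    (hlaw : P.map g = uniformOn Set.univ) (f : S → ℝ) :
    ∫ ω, f (g ω) ∂P = (∑ s, f s) / Fintype.card S := by
  have hfin : IsFiniteMeasure (uniformOn (Set.univ : Set S)) := by
    cases isEmpty_or_nonempty S
    · rw [Set.univ_eq_empty_iff.2 inferInstance, uniformOn_empty_meas]; infer_instance
    · infer_instance
  rw [← integral_map (f := f) hg.aemeasurable (Measurable.of_discrete).aestronglyMeasurable, hlaw,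
    integral_fintype (Integrable.of_finite), Finset.sum_div]
  refine Finset.sum_congr rfl fun s _ => ?_
  rw [measureReal_def, uniformOn_univ, Measure.count_singleton, ENNReal.toReal_div, smul_eq_mul]
  simp
  ring

/-- The strong law is applied only to indicators of the finitely many points; every `f` is a linear
combination of them. Hence a single null set serves all `f`, in particular functions that depend on
the training data. -/
lemma ae_equidistributed [IsProbabilityMeasure P] (hmeas : ∀ b, Measurable (θ b))
    (hindep : iIndepFun θ P) (hlaw : ∀ b, P.map (θ b) = uniformOn Set.univ) :
    ∀ᵐ ω ∂P, Equidistributed fun b => θ b ω := by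
  classical
  have hone : ∀ s : S, ∀ᵐ ω ∂P, Tendsto (fun M : ℕ =>
      (∑ b ∈ Finset.range M, if θ b ω = s then (1 : ℝ) else 0) / (M : ℝ)) atTop
        (𝓝 (1 / Fintype.card S)) := by
    intro s
    have hf : Measurable fun s' : S => if s' = s then (1 : ℝ) else 0 := Measurable.of_discrete
    have h := strong_law_ae_real (μ := P) (fun b ω => if θ b ω = s then (1 : ℝ) else 0)
      (Integrable.of_bound (hf.comp (hmeas 0)).aestronglyMeasurable 1
        (Eventually.of_forall fun ω => by
          split_ifs <;> simp))
      (fun b b' hbb' => (hindep.indepFun hbb').comp hf hf)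
      (fun b => IdentDistrib.comp (u := fun s' : S => if s' = s then (1 : ℝ) else 0)
        ⟨(hmeas b).aemeasurable, (hmeas 0).aemeasurable, by rw [hlaw, hlaw]⟩ hf)
    rw [integral_comp_of_map_eq_uniformOn (hmeas 0) (hlaw 0)
      fun s' => if s' = s then (1 : ℝ) else 0] at h
    simpa using h
  filter_upwards [ae_all_iff.2 hone] with ω hω f
  have h := tendsto_finsetSum Finset.univ fun s (_ : s ∈ Finset.univ) => (hω s).const_mul (f s)
  convert h using 1
  · ext M
    simp only [← mul_div_assoc, ← Finset.sum_div, Finset.mul_sum]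
    rw [Finset.sum_comm]
    simp
  · simp [Finset.sum_mul, div_eq_mul_inv]

end Uniform

/-! ### The variance of an average over the first `M` selected seeds -/

section Selected

variable {Ω S : Type*} [MeasurableSpace Ω] {P : Measure Ω} [Fintype S] [MeasurableSpace S]
  [DiscreteMeasurableSpace S] {θ : ℕ → Ω → S}

omit [Fintype S] [MeasurableSpace S] [DiscreteMeasurableSpace S] in
-- A function of the first `b` terms factors through a finite discrete space, so its measurability,
-- integrability and independence from term `b` cost nothing.
lemma exists_factor_prefix [Nonempty S] {b : ℕ} {h : (ℕ → S) → ℝ}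
    (hdep : ∀ u v : ℕ → S, (∀ j < b, u j = v j) → h u = h v) :
    ∃ h' : (Finset.range b → S) → ℝ, ∀ u : ℕ → S, h u = h' fun i => u i := by
  classical
  refine ⟨fun w => h fun j => if hj : j ∈ Finset.range b then w ⟨j, hj⟩ else Classical.arbitrary S,
    fun u => hdep _ _ fun j hj => ?_⟩
  simp [hj]

lemma measurable_of_prefix [Nonempty S] (hmeas : ∀ b, Measurable (θ b)) {b : ℕ}
    {h : (ℕ → S) → ℝ} (hdep : ∀ u v : ℕ → S, (∀ j < b, u j = v j) → h u = h v) :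
    Measurable fun ω => h fun j => θ j ω := by
  obtain ⟨h', hh'⟩ := exists_factor_prefix hdep
  simp only [hh']
  exact (Measurable.of_discrete (f := h')).comp (measurable_pi_lambda _ fun i => hmeas i)

lemma integrable_of_prefix [Nonempty S] [IsProbabilityMeasure P] (hmeas : ∀ b, Measurable (θ b))
    {b : ℕ} {h : (ℕ → S) → ℝ} (hdep : ∀ u v : ℕ → S, (∀ j < b, u j = v j) → h u = h v) :
    Integrable (fun ω => h fun j => θ j ω) P := by
  have hm := measurable_of_prefix hmeas hdep
  obtain ⟨h', hh'⟩ := exists_factor_prefix hdep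
  obtain ⟨C, hC⟩ := (Set.finite_range fun w => ‖h' w‖).bddAbove
  refine Integrable.of_bound hm.aestronglyMeasurable C (Eventually.of_forall fun ω => ?_)
  rw [hh']
  exact hC ⟨_, rfl⟩

lemma indepFun_prefix [Nonempty S] (hmeas : ∀ b, Measurable (θ b)) (hindep : iIndepFun θ P)
    {b : ℕ} {h : (ℕ → S) → ℝ} (hdep : ∀ u v : ℕ → S, (∀ j < b, u j = v j) → h u = h v)
    (g : S → ℝ) : IndepFun (fun ω => h fun j => θ j ω) (fun ω => g (θ b ω)) P := by
  obtain ⟨h', hh'⟩ := exists_factor_prefix hdep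
  simp only [hh']
  have hi := hindep.indepFun_finset (Finset.range b) {b} (by simp) hmeas
  exact hi.comp (φ := h') (ψ := fun w : ({b} : Finset ℕ) → S => g (w ⟨b, by simp⟩))
    Measurable.of_discrete Measurable.of_discrete

lemma integral_prefix_mul [Nonempty S] (hmeas : ∀ b, Measurable (θ b)) (hindep : iIndepFun θ P)
    {b : ℕ} {h : (ℕ → S) → ℝ} (hdep : ∀ u v : ℕ → S, (∀ j < b, u j = v j) → h u = h v)
    (g : S → ℝ) : ∫ ω, h (fun j => θ j ω) * g (θ b ω) ∂P =
      (∫ ω, h (fun j => θ j ω) ∂P) * ∫ ω, g (θ b ω) ∂P :=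
  (indepFun_prefix hmeas hindep hdep g).integral_fun_mul_eq_mul_integral
    (measurable_of_prefix hmeas hdep).aestronglyMeasurable
    ((Measurable.of_discrete (f := g)).comp (hmeas b)).aestronglyMeasurable

variable (r : S → Prop) (f : S → ℝ) (M : ℕ)

open Classical in
/-- `1` if fewer than `M` of the first `b` elements of the sequence are selected, else `0`. -/
def stillOpen (u : ℕ → S) (b : ℕ) : ℝ :=
  if Nat.count (fun b => r (u b)) b < M then 1 else 0

open Classical in
/-- The deviation of `f` from its average, on the selected elements. -/
def deviation (s : S) : ℝ := if r s then f s - condAvg r f else 0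

open Classical in
/-- The indicator of the selected elements. -/
def selected (s : S) : ℝ := if r s then 1 else 0

/-- The sum of the deviations over the selected elements among the first `B`, up to the `M`-th. -/
def deviationSum (u : ℕ → S) (B : ℕ) : ℝ :=
  ∑ b ∈ Finset.range B, stillOpen r M u b * deviation r f (u b)

/-- The number of selected elements among the first `B`, up to the `M`-th. -/
def selectedSum (u : ℕ → S) (B : ℕ) : ℝ :=
  ∑ b ∈ Finset.range B, stillOpen r M u b * selected r (u b)

omit [Fintype S] [MeasurableSpace S] [DiscreteMeasurableSpace S] in
open Classical in
lemma count_congr {r : S → Prop} {u v : ℕ → S} {b : ℕ}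
    (h : ∀ j < b, u j = v j) :
    Nat.count (fun b => r (u b)) b = Nat.count (fun b => r (v b)) b := by
  rw [Nat.count_eq_card_filter_range, Nat.count_eq_card_filter_range]
  congr 1
  exact Finset.filter_congr fun j hj => by rw [h j (Finset.mem_range.1 hj)]

omit [Fintype S] [MeasurableSpace S] [DiscreteMeasurableSpace S] in
-- The stopping weight at `b` reads only terms before `b`: it is predictable, which is what makes
-- the weighted deviations martingale increments.
lemma stillOpen_congr {u v : ℕ → S} {b : ℕ} (h : ∀ j < b, u j = v j) :
    stillOpen r M u b = stillOpen r M v b := by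
  have hc := count_congr (r := r) h
  simp only [stillOpen, hc]

omit [MeasurableSpace S] [DiscreteMeasurableSpace S] in
lemma deviationSum_congr {u v : ℕ → S} {b : ℕ} (h : ∀ j < b, u j = v j) :
    deviationSum r f M u b = deviationSum r f M v b := by
  refine Finset.sum_congr rfl fun c hc => ?_
  have hc := Finset.mem_range.1 hc
  rw [h c hc, stillOpen_congr r M fun j hj => h j (hj.trans hc)]

omit [Fintype S] [MeasurableSpace S] [DiscreteMeasurableSpace S] in
lemma selectedSum_congr {u v : ℕ → S} {b : ℕ} (h : ∀ j < b, u j = v j) :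
    selectedSum r M u b = selectedSum r M v b := by
  refine Finset.sum_congr rfl fun c hc => ?_
  have hc := Finset.mem_range.1 hc
  rw [h c hc, stillOpen_congr r M fun j hj => h j (hj.trans hc)]

omit [Fintype S] [MeasurableSpace S] [DiscreteMeasurableSpace S] in
lemma stillOpen_sq (u : ℕ → S) (b : ℕ) : stillOpen r M u b ^ 2 = stillOpen r M u b := by
  unfold stillOpen; split_ifs <;> simp

omit [Fintype S] [MeasurableSpace S] [DiscreteMeasurableSpace S] in
lemma stillOpen_nonneg (u : ℕ → S) (b : ℕ) : 0 ≤ stillOpen r M u b := by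
  unfold stillOpen; split_ifs <;> simp

omit [Fintype S] [MeasurableSpace S] [DiscreteMeasurableSpace S] in
open Classical in
lemma selectedSum_eq (u : ℕ → S) (B : ℕ) :
    selectedSum r M u B = (min (Nat.count (fun b => r (u b)) B) M : ℕ) := by
  induction B with
  | zero => simp [selectedSum]
  | succ B ih =>
    rw [selectedSum, Finset.sum_range_succ, ← selectedSum, ih, Nat.count_succ, stillOpen, selected]
    by_cases h1 : Nat.count (fun b => r (u b)) B < M <;> by_cases h2 : r (u B) <;>
      simp only [h1, h2, if_true, if_false, mul_one, mul_zero, add_zero]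
    · rw [min_eq_left h1.le, min_eq_left (by omega)]; push_cast; ring
    · rw [min_eq_right (by omega), min_eq_right (by omega)]

omit [Fintype S] [MeasurableSpace S] [DiscreteMeasurableSpace S] in
lemma selectedSum_le (u : ℕ → S) (B : ℕ) : selectedSum r M u B ≤ M := by
  rw [selectedSum_eq]
  exact_mod_cast min_le_right _ _

omit [MeasurableSpace S] [DiscreteMeasurableSpace S] in
lemma abs_deviation_le {K : ℝ} (hK : 0 ≤ K) (hf : ∀ s, |f s| ≤ K) (s : S) :
    |deviation r f s| ≤ 2 * K * selected r s := by
  unfold deviation selected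
  split_ifs
  · have h1 := hf s
    have h2 : |condAvg r f| ≤ K := abs_sum_div_card_le _ _ hK fun s _ => hf s
    have := abs_sub (f s) (condAvg r f)
    linarith
  · simp

omit [MeasurableSpace S] [DiscreteMeasurableSpace S] in
-- At most `M` summands are nonzero, however large `B` is; this uniform bound is the dominating
-- constant for the limit `B → ∞`.
lemma abs_deviationSum_le {K : ℝ} (hK : 0 ≤ K) (hf : ∀ s, |f s| ≤ K) (u : ℕ → S) (B : ℕ) :
    |deviationSum r f M u B| ≤ 2 * K * M := by
  calc |deviationSum r f M u B|
      ≤ ∑ b ∈ Finset.range B, |stillOpen r M u b * deviation r f (u b)| :=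
        Finset.abs_sum_le_sum_abs _ _
    _ ≤ ∑ b ∈ Finset.range B, 2 * K * (stillOpen r M u b * selected r (u b)) := by
        refine Finset.sum_le_sum fun b _ => ?_
        rw [abs_mul, abs_of_nonneg (stillOpen_nonneg r M u b)]
        have := mul_le_mul_of_nonneg_left (abs_deviation_le r f hK hf (u b))
          (stillOpen_nonneg r M u b)
        linarith
    _ = 2 * K * selectedSum r M u B := by rw [selectedSum, Finset.mul_sum]
    _ ≤ 2 * K * M := mul_le_mul_of_nonneg_left (selectedSum_le r M u B) (by positivity)

omit [MeasurableSpace S] [DiscreteMeasurableSpace S] in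
lemma sum_deviation (hr : ∃ s, r s) : ∑ s, deviation r f s = 0 := by
  classical
  obtain ⟨s, hs⟩ := hr
  have hpos : ((Finset.univ.filter r).card : ℝ) ≠ 0 := by
    exact_mod_cast (Finset.card_pos.2 ⟨s, by simpa using hs⟩).ne'
  simp only [deviation]
  rw [← Finset.sum_filter, Finset.sum_sub_distrib, Finset.sum_const, nsmul_eq_mul, condAvg]
  rw [sub_eq_zero]
  field_simp

omit [MeasurableSpace S] [DiscreteMeasurableSpace S] in
lemma sum_deviation_sq_le {K : ℝ} (hf : ∀ s, |f s| ≤ K) (hr : ∃ s, r s) :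
    ∑ s, deviation r f s ^ 2 ≤ K ^ 2 * ∑ s, selected r s := by
  have h0 := sum_deviation r f hr
  -- With `c = condAvg r f`, `(f - c) ^ 2 = f ^ 2 - c ^ 2 - 2 * c * (f - c)` on selected elements;
  -- the last term sums to zero.
  have key : ∀ s, deviation r f s ^ 2 ≤
      K ^ 2 * selected r s - 2 * condAvg r f * deviation r f s := by
    intro s
    unfold deviation selected
    split_ifs
    · have := sq_le_sq.2 ((hf s).trans (le_abs_self K))
      nlinarith [sq_nonneg (condAvg r f)]
    · simp
  calc ∑ s, deviation r f s ^ 2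
      ≤ ∑ s, (K ^ 2 * selected r s - 2 * condAvg r f * deviation r f s) :=
        Finset.sum_le_sum fun s _ => key s
    _ = K ^ 2 * ∑ s, selected r s := by
        rw [Finset.sum_sub_distrib, ← Finset.mul_sum, ← Finset.mul_sum, h0]; ring

/-- Each increment is a predictable weight times an independent variable of mean zero. -/
lemma integral_deviationSum [Nonempty S] [IsProbabilityMeasure P] (hmeas : ∀ b, Measurable (θ b))
    (hindep : iIndepFun θ P) (hlaw : ∀ b, P.map (θ b) = uniformOn Set.univ) (hr : ∃ s, r s)
    (B : ℕ) : ∫ ω, deviationSum r f M (fun j => θ j ω) B ∂P = 0 := by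
  induction B with
  | zero => simp [deviationSum]
  | succ B ih =>
    simp only [deviationSum, Finset.sum_range_succ]
    rw [integral_add, integral_prefix_mul (h := fun u => stillOpen r M u B) hmeas hindep
      (fun u v h => stillOpen_congr r M h), integral_comp_of_map_eq_uniformOn (hmeas B) (hlaw B),
      sum_deviation r f hr]
    · simpa [deviationSum] using ih
    · exact integrable_of_prefix (b := B) hmeas (h := fun u => deviationSum r f M u B)
        fun u v h => deviationSum_congr r f M h
    · exact integrable_of_prefix (b := B + 1) hmeas
        (h := fun u => stillOpen r M u B * deviation r f (u B)) fun u v h => by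
          rw [h B (by omega), stillOpen_congr r M fun j hj => h j (by omega)]

/-- An inequality version of Wald's second identity. Cross terms vanish by independence, and each
squared increment is at most `K ^ 2` times the probability that step `B` makes a selection while
fewer than `M` have been made. -/
lemma integral_deviationSum_sq_le_aux [Nonempty S] [IsProbabilityMeasure P]
    (hmeas : ∀ b, Measurable (θ b)) (hindep : iIndepFun θ P)
    (hlaw : ∀ b, P.map (θ b) = uniformOn Set.univ) (hr : ∃ s, r s) {K : ℝ}
    (hf : ∀ s, |f s| ≤ K) (B : ℕ) :
    ∫ ω, deviationSum r f M (fun j => θ j ω) B ^ 2 ∂P ≤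
      K ^ 2 * ∫ ω, selectedSum r M (fun j => θ j ω) B ∂P := by
  induction B with
  | zero => simp [deviationSum, selectedSum]
  | succ B ih =>
    have hopen : ∀ u v : ℕ → S, (∀ j < B, u j = v j) →
        stillOpen r M u B = stillOpen r M v B := fun u v h => stillOpen_congr r M h
    have e1 : ∀ ω, deviationSum r f M (fun j => θ j ω) (B + 1) ^ 2 =
        deviationSum r f M (fun j => θ j ω) B ^ 2 +
          (2 * deviationSum r f M (fun j => θ j ω) B * stillOpen r M (fun j => θ j ω) B) *
            deviation r f (θ B ω) +
          stillOpen r M (fun j => θ j ω) B * deviation r f (θ B ω) ^ 2 := by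
      intro ω
      rw [deviationSum, Finset.sum_range_succ, ← deviationSum]
      -- The weight is `0` or `1`, hence equal to its square.
      linear_combination deviation r f (θ B ω) ^ 2 * stillOpen_sq r M (fun j => θ j ω) B
    have e2 : ∀ ω, selectedSum r M (fun j => θ j ω) (B + 1) =
        selectedSum r M (fun j => θ j ω) B +
          stillOpen r M (fun j => θ j ω) B * selected r (θ B ω) := by
      intro ω
      rw [selectedSum, Finset.sum_range_succ, ← selectedSum]
    have hcross : ∀ u v : ℕ → S, (∀ j < B, u j = v j) →
        2 * deviationSum r f M u B * stillOpen r M u B =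
          2 * deviationSum r f M v B * stillOpen r M v B := fun u v h => by
      rw [deviationSum_congr r f M h, hopen u v h]
    have i1 : Integrable (fun ω => deviationSum r f M (fun j => θ j ω) B ^ 2) P :=
      integrable_of_prefix (b := B) hmeas (h := fun u => deviationSum r f M u B ^ 2)
        fun u v h => by rw [deviationSum_congr r f M h]
    have i2 : Integrable (fun ω => (2 * deviationSum r f M (fun j => θ j ω) B *
        stillOpen r M (fun j => θ j ω) B) * deviation r f (θ B ω)) P :=
      integrable_of_prefix (b := B + 1) hmeas (h := fun u =>
        2 * deviationSum r f M u B * stillOpen r M u B * deviation r f (u B)) fun u v h => by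
          rw [h B (by omega), hcross u v fun j hj => h j (by omega)]
    have i3 : Integrable (fun ω => stillOpen r M (fun j => θ j ω) B *
        deviation r f (θ B ω) ^ 2) P :=
      integrable_of_prefix (b := B + 1) hmeas (h := fun u =>
        stillOpen r M u B * deviation r f (u B) ^ 2) fun u v h => by
          rw [h B (by omega), hopen u v fun j hj => h j (by omega)]
    have i4 : Integrable (fun ω => selectedSum r M (fun j => θ j ω) B) P :=
      integrable_of_prefix (b := B) hmeas (h := fun u => selectedSum r M u B)
        fun u v h => by rw [selectedSum_congr r M h]
    have i5 : Integrable (fun ω => stillOpen r M (fun j => θ j ω) B * selected r (θ B ω)) P :=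
      integrable_of_prefix (b := B + 1) hmeas (h := fun u =>
        stillOpen r M u B * selected r (u B)) fun u v h => by
          rw [h B (by omega), hopen u v fun j hj => h j (by omega)]
    simp only [e1, e2]
    rw [integral_add ?_ i3, integral_add i1 i2, integral_add i4 i5,
      integral_prefix_mul (h := fun u => 2 * deviationSum r f M u B * stillOpen r M u B) hmeas
        hindep hcross, integral_prefix_mul (h := fun u => stillOpen r M u B) hmeas hindep hopen
        (fun s => deviation r f s ^ 2),
      integral_prefix_mul (h := fun u => stillOpen r M u B) hmeas hindep hopen,
      integral_comp_of_map_eq_uniformOn (hmeas B) (hlaw B),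
      integral_comp_of_map_eq_uniformOn (hmeas B) (hlaw B) fun s => deviation r f s ^ 2,
      integral_comp_of_map_eq_uniformOn (hmeas B) (hlaw B), sum_deviation r f hr]
    swap
    · exact i1.add i2
    have hc : 0 ≤ ∫ ω, stillOpen r M (fun j => θ j ω) B ∂P :=
      integral_nonneg fun ω => stillOpen_nonneg r M _ B
    have hV : (∑ s, deviation r f s ^ 2) / (Fintype.card S : ℝ) ≤
        K ^ 2 * ((∑ s, selected r s) / Fintype.card S) := by
      rw [← mul_div_assoc]
      gcongr
      exact sum_deviation_sq_le r f hf hr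
    have := mul_le_mul_of_nonneg_left hV hc
    rw [zero_div, mul_zero, add_zero]
    linarith

lemma integral_deviationSum_sq_le [Nonempty S] [IsProbabilityMeasure P]
    (hmeas : ∀ b, Measurable (θ b)) (hindep : iIndepFun θ P)
    (hlaw : ∀ b, P.map (θ b) = uniformOn Set.univ) (hr : ∃ s, r s) {K : ℝ}
    (hf : ∀ s, |f s| ≤ K) (B : ℕ) :
    ∫ ω, deviationSum r f M (fun j => θ j ω) B ^ 2 ∂P ≤ K ^ 2 * M := by
  refine (integral_deviationSum_sq_le_aux r f M hmeas hindep hlaw hr hf B).trans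
    (mul_le_mul_of_nonneg_left ?_ (sq_nonneg K))
  calc ∫ ω, selectedSum r M (fun j => θ j ω) B ∂P ≤ ∫ ω, (M : ℝ) ∂P :=
        integral_mono (integrable_of_prefix (b := B) hmeas (h := fun u => selectedSum r M u B)
          fun u v h => by rw [selectedSum_congr r M h]) (integrable_const _)
          fun ω => selectedSum_le r M _ B
    _ = M := by simp

/-- The average of `f` over the first `M` selected elements of a sequence. -/
def selectedAvg (u : ℕ → S) : ℝ :=
  (∑ k ∈ Finset.range M, f (u (Nat.nth (fun b => r (u b)) k))) / (M : ℝ)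

omit [MeasurableSpace S] [DiscreteMeasurableSpace S] in
lemma deviationSum_eventually_eq (hM : M ≠ 0) {u : ℕ → S} (hu : {b | r (u b)}.Infinite) :
    ∀ᶠ B in atTop, deviationSum r f M u B = M * (selectedAvg r f M u - condAvg r f) := by
  classical
  -- `Nat.nth` counts from `0`, so this is the position of selection number `M + 1`; beyond it the
  -- stopped sum is frozen with exactly `M` selections.
  filter_upwards [eventually_ge_atTop (Nat.nth (fun b => r (u b)) M)] with B hB
  have hM' : (M : ℝ) ≠ 0 := by exact_mod_cast hM
  rw [selectedAvg, mul_sub, mul_div_cancel₀ _ hM']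
  have hsum := sum_range_nth hu (fun b => f (u b) - condAvg r f) M
  rw [Finset.sum_sub_distrib, Finset.sum_const, Finset.card_range, nsmul_eq_mul] at hsum
  rw [hsum, Finset.sum_filter, deviationSum,
    ← Finset.sum_subset (Finset.range_subset_range.2 hB)]
  · refine Finset.sum_congr rfl fun b hb => ?_
    unfold deviation stillOpen
    by_cases hrb : r (u b)
    · have : Nat.count (fun b => r (u b)) b < M := by
        rw [← Nat.nth_lt_nth hu, Nat.nth_count (p := fun b => r (u b)) hrb]
        exact Finset.mem_range.1 hb
      simp [hrb, this]
    · simp [hrb]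
  · intro b _ hb
    unfold deviation stillOpen
    by_cases hrb : r (u b)
    · have : ¬ Nat.count (fun b => r (u b)) b < M := by
        rw [← Nat.nth_lt_nth hu, Nat.nth_count (p := fun b => r (u b)) hrb]
        exact fun h => hb (Finset.mem_range.2 h)
      simp [this]
    · simp [hrb]

/-- The mean squared error of an average over the first `M` selected elements. -/
lemma integral_sub_selectedAvg_sq_le [IsProbabilityMeasure P]
    (hmeas : ∀ b, Measurable (θ b)) (hindep : iIndepFun θ P)
    (hlaw : ∀ b, P.map (θ b) = uniformOn Set.univ) (hr : ∃ s, r s) {K : ℝ} (hK : 0 ≤ K)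
    (hf : ∀ s, |f s| ≤ K) (hM : M ≠ 0) (c : ℝ) :
    ∫ ω, (c - selectedAvg r f M fun j => θ j ω) ^ 2 ∂P ≤ (c - condAvg r f) ^ 2 + K ^ 2 / M := by
  have hne : Nonempty S := ⟨hr.choose⟩
  -- The number of seeds inspected before the `M`-th selection is random and unbounded. So `D` is
  -- treated as the limit of the sums stopped at a fixed `B`, and both of its moments come from
  -- dominated convergence.
  set D : Ω → ℝ := fun ω => M * ((selectedAvg r f M fun j => θ j ω) - condAvg r f) with hD
  have hM' : (M : ℝ) ≠ 0 := by exact_mod_cast hM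
  have hMpos : (0 : ℝ) < M := by positivity
  have hae : ∀ᵐ ω ∂P, ∀ᶠ B in atTop, deviationSum r f M (fun j => θ j ω) B = D ω := by
    filter_upwards [ae_equidistributed hmeas hindep hlaw] with ω hω
    exact deviationSum_eventually_eq r f M hM (hω.infinite hr)
  have hlim : ∀ᵐ ω ∂P, Tendsto (fun B => deviationSum r f M (fun j => θ j ω) B) atTop
      (𝓝 (D ω)) := by
    filter_upwards [hae] with ω hω
    exact tendsto_const_nhds.congr' (hω.mono fun B hB => hB.symm)
  have hm : ∀ B, AEStronglyMeasurable (fun ω => deviationSum r f M (fun j => θ j ω) B) P :=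
    fun B => (measurable_of_prefix (b := B) (h := fun u => deviationSum r f M u B) hmeas
      fun u v h => deviationSum_congr r f M h).aestronglyMeasurable
  have hDm : AEStronglyMeasurable D P := aestronglyMeasurable_of_tendsto_ae atTop hm hlim
  have hbound : ∀ B ω, |deviationSum r f M (fun j => θ j ω) B| ≤ 2 * K * M :=
    fun B ω => abs_deviationSum_le r f M hK hf _ B
  have hDbound : ∀ᵐ ω ∂P, ‖D ω‖ ≤ 2 * K * M := by
    filter_upwards [hlim] with ω hω
    exact le_of_tendsto' hω.norm fun B => hbound B ω
  have hDint : Integrable D P := Integrable.of_bound hDm _ hDbound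
  have hDint2 : Integrable (fun ω => D ω ^ 2) P :=
    Integrable.of_bound (hDm.pow 2) ((2 * K * M) ^ 2) (by
      filter_upwards [hDbound] with ω hω
      rw [norm_pow]
      exact pow_le_pow_left₀ (norm_nonneg _) hω 2)
  have h1 : ∫ ω, D ω ∂P = 0 := by
    have h := tendsto_integral_of_dominated_convergence (fun _ => 2 * K * M) hm
      (integrable_const _) (fun B => Eventually.of_forall fun ω => hbound B ω) hlim
    simp only [integral_deviationSum r f M hmeas hindep hlaw hr] at h
    exact (tendsto_nhds_unique h tendsto_const_nhds)
  have h2 : ∫ ω, D ω ^ 2 ∂P ≤ K ^ 2 * M := by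
    have h := tendsto_integral_of_dominated_convergence (fun _ => (2 * K * M) ^ 2)
      (fun B => (hm B).pow 2) (integrable_const _) (fun B => Eventually.of_forall fun ω => by
        simp only [Pi.pow_apply, norm_pow]
        exact pow_le_pow_left₀ (norm_nonneg _) (hbound B ω) 2)
      (by filter_upwards [hlim] with ω hω using hω.pow 2)
    exact le_of_tendsto' h fun B => integral_deviationSum_sq_le r f M hmeas hindep hlaw hr hf B
  -- Bias-variance decomposition: `c - selectedAvg = (c - condAvg) - D / M`, whose cross term has
  -- mean zero.
  have e : ∀ ω, (c - selectedAvg r f M fun j => θ j ω) ^ 2 = (c - condAvg r f) ^ 2 -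
      2 * (c - condAvg r f) / M * D ω + 1 / (M : ℝ) ^ 2 * D ω ^ 2 := by
    intro ω
    simp only [hD]
    field_simp
    ring
  simp only [e]
  clear_value D
  rw [integral_add (by fun_prop) (by fun_prop), integral_sub (by fun_prop) (by fun_prop),
    integral_const_mul, integral_const_mul, h1]
  simp only [integral_const, probReal_univ, one_smul, mul_zero, sub_zero]
  have : 1 / (M : ℝ) ^ 2 * ∫ ω, D ω ^ 2 ∂P ≤ 1 / (M : ℝ) ^ 2 * (K ^ 2 * M) := by gcongr
  have e3 : 1 / (M : ℝ) ^ 2 * (K ^ 2 * M) = K ^ 2 / M := by field_simp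
  linarith

end Selected

/-! ### Independent and identically distributed pairs -/

section Iid

variable {Ω : Type*} [MeasurableSpace Ω] {P : Measure Ω} [IsProbabilityMeasure P]

/-- Both laws agree on boxes whose sides are rectangles `u i ×ˢ v i`, which form a generating
π-system; there the three independence assumptions factor the probability. -/
lemma map_prodMk_eq_pi {ι α β : Type*} [Fintype ι] [MeasurableSpace α] [MeasurableSpace β]
    {X : ι → Ω → α} {Z : ι → Ω → β} (hX : ∀ i, Measurable (X i)) (hZ : ∀ i, Measurable (Z i))
    (hXi : iIndepFun X P) (hZi : iIndepFun Z P)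
    (hXZ : IndepFun (fun ω i => X i ω) (fun ω i => Z i ω) P) :
    P.map (fun ω i => (X i ω, Z i ω)) =
      Measure.pi fun i => (P.map (X i)).prod (P.map (Z i)) := by
  have hp1 : ∀ i, IsProbabilityMeasure (P.map (X i)) :=
    fun i => Measure.isProbabilityMeasure_map (hX i).aemeasurable
  have hp2 : ∀ i, IsProbabilityMeasure (P.map (Z i)) :=
    fun i => Measure.isProbabilityMeasure_map (hZ i).aemeasurable
  have hXm : Measurable fun ω i => X i ω := measurable_pi_lambda _ hX
  have hZm : Measurable fun ω i => Z i ω := measurable_pi_lambda _ hZ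
  refine (Measure.pi_eq_generateFrom (fun _ => generateFrom_prod) (fun _ => isPiSystem_prod)
    (fun i => ?_) ?_).symm
  · exact ((P.map (X i)).toFiniteSpanningSetsIn.prod (P.map (Z i)).toFiniteSpanningSetsIn)
  · intro s hs
    choose u hu v hv huv using hs
    have e : (fun ω i => (X i ω, Z i ω)) ⁻¹' Set.univ.pi s =
        (fun ω i => X i ω) ⁻¹' Set.univ.pi u ∩ (fun ω i => Z i ω) ⁻¹' Set.univ.pi v := by
      ext ω
      simp only [← huv, Set.mem_preimage, Set.mem_pi, Set.mem_univ, true_imp_iff, Set.mem_prod,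
        Set.mem_inter_iff, forall_and]
    have hs' : ∀ i, MeasurableSet (s i) := fun i => by
      rw [← huv i]
      exact MeasurableSet.prod (hu i) (hv i)
    rw [Measure.map_apply (measurable_pi_lambda _ fun i => (hX i).prodMk (hZ i))
      (MeasurableSet.univ_pi hs'), e,
      hXZ.measure_inter_preimage_eq_mul _ _ (MeasurableSet.univ_pi hu) (MeasurableSet.univ_pi hv),
      ← Measure.map_apply hXm (MeasurableSet.univ_pi hu),
      ← Measure.map_apply hZm (MeasurableSet.univ_pi hv),
      (iIndepFun_iff_map_fun_eq_pi_map fun i => (hX i).aemeasurable).1 hXi,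
      (iIndepFun_iff_map_fun_eq_pi_map fun i => (hZ i).aemeasurable).1 hZi,
      Measure.pi_pi, Measure.pi_pi, ← Finset.prod_mul_distrib]
    exact Finset.prod_congr rfl fun i _ => by rw [← huv i, Measure.prod_prod]

/-- Pairing two independent families of independent random variables gives an independent
family. -/
lemma iIndepFun_prodMk_of_indepFun {ι α β : Type*} [MeasurableSpace α] [MeasurableSpace β]
    {X : ι → Ω → α} {Z : ι → Ω → β} (hX : ∀ i, Measurable (X i)) (hZ : ∀ i, Measurable (Z i))
    (hXi : iIndepFun X P) (hZi : iIndepFun Z P)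
    (hXZ : IndepFun (fun ω i => X i ω) (fun ω i => Z i ω) P) :
    iIndepFun (fun i ω => (X i ω, Z i ω)) P := by
  rw [iIndepFun_iff_finset]
  intro s
  have hXZs : IndepFun (fun ω (i : s) => X i ω) (fun ω (i : s) => Z i ω) P :=
    hXZ.comp (φ := fun w (i : s) => w i) (ψ := fun w (i : s) => w i)
      (measurable_pi_lambda _ fun i => measurable_pi_apply _)
      (measurable_pi_lambda _ fun i => measurable_pi_apply _)
  have h := map_prodMk_eq_pi (fun i : s => hX i) (fun i : s => hZ i)
    (hXi.precomp Subtype.val_injective) (hZi.precomp Subtype.val_injective) hXZs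
  refine (iIndepFun_iff_map_fun_eq_pi_map fun i : s =>
    ((hX i).prodMk (hZ i)).aemeasurable).2 (h.trans ?_)
  congr 1
  ext1 i
  refine ((indepFun_iff_map_prod_eq_prod_map_map (hX i).aemeasurable (hZ i).aemeasurable).1 ?_).symm
  have h1 : Measurable fun w : ι → α => w i.1 := measurable_pi_apply i.1
  have h2 : Measurable fun w : ι → β => w i.1 := measurable_pi_apply i.1
  exact hXZ.comp h1 h2

variable {E : Type*} [MeasurableSpace E] {W : ℕ → Ω → E}

/-- Exchangeability: the law does not depend on which distinct observations are picked, nor on their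
order. -/
lemma map_injective_eq_pi (hW : ∀ i, Measurable (W i)) (hindep : iIndepFun W P)
    (hident : ∀ i, IdentDistrib (W i) (W 0) P P) {ι : Type*} [Fintype ι] {τ : ι → ℕ}
    (hτ : Function.Injective τ) :
    P.map (fun ω k => W (τ k) ω) = Measure.pi fun _ => P.map (W 0) := by
  rw [(iIndepFun_iff_map_fun_eq_pi_map fun k => (hW (τ k)).aemeasurable).1 (hindep.precomp hτ)]
  congr 1
  ext1 k
  exact (hident (τ k)).map_eq

/-- Conditionally on the common observations, two copies of a statistic are independent and
identically distributed; hence their correlation is nonnegative. -/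
lemma integral_mul_nonneg_of_shared (hW : ∀ i, Measurable (W i)) (hindep : iIndepFun W P)
    (hident : ∀ i, IdentDistrib (W i) (W 0) P P) {α δ : Type*} [Fintype α] [Fintype δ]
    {u : α → ℕ} {v v' : δ → ℕ} (hinj : Function.Injective (Sum.elim u (Sum.elim v v')))
    {Φ : (α → E) × (δ → E) → ℝ} (hΦ : Measurable Φ)
    (hint : Integrable (fun ω => Φ (fun i => W (u i) ω, fun i => W (v i) ω) *
      Φ (fun i => W (u i) ω, fun i => W (v' i) ω)) P) :
    0 ≤ ∫ ω, Φ (fun i => W (u i) ω, fun i => W (v i) ω) *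
      Φ (fun i => W (u i) ω, fun i => W (v' i) ω) ∂P := by
  set ν := P.map (W 0)
  have hν : IsProbabilityMeasure ν := Measure.isProbabilityMeasure_map (hW 0).aemeasurable
  have h0 : MeasurePreserving (fun ω (k : α ⊕ (δ ⊕ δ)) => W (Sum.elim u (Sum.elim v v') k) ω) P
      (Measure.pi fun _ => ν) :=
    ⟨measurable_pi_lambda _ fun k => hW _, map_injective_eq_pi hW hindep hident hinj⟩
  have h1 := measurePreserving_sumPiEquivProdPi (X := fun _ : α ⊕ (δ ⊕ δ) => E) fun _ => ν
  have h2 := measurePreserving_sumPiEquivProdPi (X := fun _ : δ ⊕ δ => E) fun _ => ν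
  have h3 := (((MeasurePreserving.id (Measure.pi fun _ : α => ν)).prod h2).comp h1).comp h0
  have hH : Measurable fun w : (α → E) × (δ → E) × (δ → E) =>
      Φ (w.1, w.2.1) * Φ (w.1, w.2.2) := by fun_prop
  have hint' : Integrable (fun w : (α → E) × (δ → E) × (δ → E) =>
      Φ (w.1, w.2.1) * Φ (w.1, w.2.2)) _ := (h3.integrable_comp hH.aestronglyMeasurable).1 hint
  have e := integral_map (μ := P) h3.measurable.aemeasurable
    (f := fun w : (α → E) × (δ → E) × (δ → E) => Φ (w.1, w.2.1) * Φ (w.1, w.2.2))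
    hH.aestronglyMeasurable
  rw [h3.map_eq, integral_prod _ hint'] at e
  refine le_of_le_of_eq (integral_nonneg fun w => ?_) e
  simp only [Pi.zero_apply]
  -- For fixed shared observations `w` the two remaining blocks are independent with the same law,
  -- so the inner integral is a square.
  rw [integral_prod_mul (fun b => Φ (w, b)) (fun b => Φ (w, b))]
  exact mul_self_nonneg _

end Iid

/-! ### Averages over bags -/

/-- A pair is counted once for each `i` outside both bags. Since `e` is nonnegative, the condition
on the second bag may be dropped, and `n - a` indices lie outside the first. -/
lemma sum_filter_card_le {n : ℕ} {B : Type*} [Fintype B] [DecidableEq B]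
    (mem : Fin n → B → Prop) [∀ i, DecidablePred (mem i)] {a : ℕ} (ha : a ≤ n)
    (hcard : ∀ S, (Finset.univ.filter fun i => mem i S).card = a) (e : B → B → ℝ)
    (he : ∀ S S', 0 ≤ e S S') :
    ∑ i, ∑ S with ¬ mem i S, ∑ S' with ¬ mem i S', e S S' ≤
      ((n : ℝ) - a) * ∑ S, ∑ S', e S S' := by
  have h1 : ∀ i, ∑ S with ¬ mem i S, ∑ S' with ¬ mem i S', e S S' ≤
      ∑ S, ∑ S', if ¬ mem i S then e S S' else 0 := by
    intro i
    rw [Finset.sum_filter]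
    refine Finset.sum_le_sum fun S _ => ?_
    split_ifs with h
    · simp
    · exact Finset.sum_le_sum_of_subset_of_nonneg (Finset.filter_subset _ _)
        fun S' _ _ => he S S'
  refine (Finset.sum_le_sum fun i _ => h1 i).trans (le_of_eq ?_)
  rw [Finset.sum_comm, Finset.mul_sum]
  refine Finset.sum_congr rfl fun S _ => ?_
  rw [Finset.sum_comm, Finset.mul_sum]
  refine Finset.sum_congr rfl fun S' _ => ?_
  rw [← Finset.sum_filter, Finset.sum_const, nsmul_eq_mul, Finset.filter_not,
    Finset.card_sdiff_of_subset (Finset.filter_subset _ _), hcard S, Finset.card_univ,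
    Fintype.card_fin, Nat.cast_sub ha]

/-- The average of the predictions of the trees with bag `S`. -/
def bagPredict (q t : ℕ) (S : {s : Finset (Fin n) // s.card = a}) (x : Fin n → Fin p → ℝ)
    (y : Fin n → ℝ) (z : Fin p → ℝ) : ℝ :=
  (∑ d, treePredict x y (⟨S, d⟩ : TreeSeed n p a q t) z) /
    Fintype.card (Fin (2 * t) → {f : Finset (Fin p) // f.card = q})

lemma card_treeSeed : Fintype.card (TreeSeed n p a q t) =
    Fintype.card {s : Finset (Fin n) // s.card = a} *
      Fintype.card (Fin (2 * t) → {f : Finset (Fin p) // f.card = q}) := by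
  rw [Fintype.card_congr (seedEquiv n p a q t), Fintype.card_prod]

lemma meanPredict_eq_bag (x : Fin n → Fin p → ℝ) (y : Fin n → ℝ) (z : Fin p → ℝ) :
    meanPredict a q t x y z = (∑ S : {s : Finset (Fin n) // s.card = a}, bagPredict q t S x y z) /
      Fintype.card {s : Finset (Fin n) // s.card = a} := by
  simp only [bagPredict, meanPredict]
  rw [← Finset.sum_div, div_div, card_treeSeed, Nat.cast_mul, mul_comm (Fintype.card _ : ℝ)]
  congr 1
  rw [← (seedEquiv n p a q t).symm.sum_comp, Fintype.sum_prod_type]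
  rfl

/-- Whether `i` is out of bag is decided by the bag alone, so the average over directions splits off
and its cardinality cancels. -/
lemma oobMean_eq_bag (x : Fin n → Fin p → ℝ) (y : Fin n → ℝ) (i : Fin n) :
    oobMean a q t x y i =
      (∑ S : {s : Finset (Fin n) // s.card = a} with i ∉ S.1, bagPredict q t S x y (x i)) /
        ((Finset.univ.filter fun S : {s : Finset (Fin n) // s.card = a} => i ∉ S.1).card : ℝ) := by
  classical
  have hset : (Finset.univ.filter fun s : TreeSeed n p a q t => i ∉ s.bag.1) =
      ((Finset.univ.filter fun S : {s : Finset (Fin n) // s.card = a} => i ∉ S.1) ×ˢ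
        (Finset.univ : Finset (Fin (2 * t) → {f : Finset (Fin p) // f.card = q}))).map
          (seedEquiv n p a q t).symm.toEmbedding := by
    ext s
    simp only [Finset.mem_filter, Finset.mem_univ, true_and, Finset.mem_map_equiv,
      Equiv.symm_symm, Finset.mem_product, and_true]
    rfl
  have e : oobMean a q t x y i = (∑ s : TreeSeed n p a q t with i ∉ s.bag.1,
      treePredict x y s (x i)) /
        ((Finset.univ.filter fun s : TreeSeed n p a q t => i ∉ s.bag.1).card : ℝ) := by
    unfold oobMean condAvg
    congr!
  simp only [bagPredict]
  rw [e, hset, Finset.sum_map, Finset.card_map, Finset.card_product, Finset.sum_product,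
    ← Finset.sum_div, div_div, Nat.cast_mul, mul_comm (Finset.card _ : ℝ), Finset.card_univ]
  rfl

lemma card_bag_notMem (i : Fin n) :
    (Finset.univ.filter fun S : {s : Finset (Fin n) // s.card = a} => i ∉ S.1).card =
      (n - 1).choose a := by
  rw [← Finset.card_map (Function.Embedding.subtype _)]
  have : (Finset.univ.filter fun S : {s : Finset (Fin n) // s.card = a} => i ∉ S.1).map
      (Function.Embedding.subtype _) = Finset.powersetCard a (Finset.univ.erase i) := by
    ext s
    simp only [Finset.mem_map, Finset.mem_filter, Finset.mem_univ, true_and,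
      Function.Embedding.subtype_apply, Subtype.exists, exists_and_left, exists_prop,
      exists_eq_right_right, Finset.mem_powersetCard, Finset.subset_erase, Finset.subset_univ]
  rw [this, Finset.card_powersetCard, Finset.card_erase_of_mem (Finset.mem_univ i),
    Finset.card_univ, Fintype.card_fin]

lemma card_bag : Fintype.card {s : Finset (Fin n) // s.card = a} = n.choose a := by
  rw [Fintype.card_finset_len, Fintype.card_fin]

/-- The bag consisting of all points. -/
def fullBag (a : ℕ) : {s : Finset (Fin a) // s.card = a} := ⟨Finset.univ, by simp⟩

/-- The enumeration `τ` of the bag is arbitrary. This freedom lets two bags list their common points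
in the same places. -/
lemma bagPredict_eq_comp (τ : Fin a ↪ Fin n) (S : {s : Finset (Fin n) // s.card = a})
    (h : Finset.univ.map τ = S.1) (x : Fin n → Fin p → ℝ) (y : Fin n → ℝ) (z : Fin p → ℝ) :
    bagPredict q t S x y z = bagPredict q t (fullBag a) (x ∘ τ) (y ∘ τ) z := by
  unfold bagPredict
  congr 1
  exact Finset.sum_congr rfl fun d _ => treePredict_map τ x y S (fullBag a) h d z

lemma bagPredict_congr (S : {s : Finset (Fin n) // s.card = a}) {x x' : Fin n → Fin p → ℝ}
    {y y' : Fin n → ℝ} (hx : ∀ j ∈ S.1, x j = x' j) (hy : ∀ j ∈ S.1, y j = y' j)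
    (z : Fin p → ℝ) : bagPredict q t S x y z = bagPredict q t S x' y' z := by
  have hτ : Finset.univ.map (S.1.orderEmbOfFin S.2).toEmbedding = S.1 :=
    Finset.map_orderEmbOfFin_univ S.1 S.2
  have hmem : ∀ k, (S.1.orderEmbOfFin S.2).toEmbedding k ∈ S.1 :=
    fun k => Finset.orderEmbOfFin_mem S.1 S.2 k
  rw [bagPredict_eq_comp _ S hτ, bagPredict_eq_comp _ S hτ]
  congr 1 <;> ext1 k
  · exact hx _ (hmem k)
  · exact hy _ (hmem k)

lemma abs_bagPredict_le (S : {s : Finset (Fin n) // s.card = a}) (x : Fin n → Fin p → ℝ)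
    (y : Fin n → ℝ) (z : Fin p → ℝ) : |bagPredict q t S x y z| ≤ ‖y‖ := by
  have h := abs_sum_div_card_le Finset.univ
    (fun d => treePredict x y (⟨S, d⟩ : TreeSeed n p a q t) z)
    (norm_nonneg y) fun _ _ => abs_treePredict_le _ _ _ _
  rwa [Finset.card_univ] at h

lemma measurable_bagPredict {δ : Type*} [MeasurableSpace δ] {x : δ → Fin n → Fin p → ℝ}
    {y : δ → Fin n → ℝ} {z : δ → Fin p → ℝ} (hx : Measurable x) (hy : Measurable y)
    (hz : Measurable z) (S : {s : Finset (Fin n) // s.card = a}) :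
    Measurable fun d => bagPredict q t S (x d) (y d) (z d) :=
  (Finset.measurable_sum _ fun d _ => measurable_treePredict hx hy hz ⟨S, d⟩).div_const _

/-! ### Comparison of the out-of-bag error with the error at an unseen point -/

section Comparison

variable {Ω : Type*} [MeasurableSpace Ω] {P : Measure Ω} [IsProbabilityMeasure P]
  {X : ℕ → Ω → Fin p → ℝ} {Y : ℕ → Ω → ℝ} {m : (Fin p → ℝ) → ℝ}

lemma measurable_trainX (hX : ∀ i, Measurable (X i)) (n : ℕ) : Measurable (trainX X n) :=
  measurable_pi_lambda _ fun i => hX (i + 1)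

lemma measurable_trainY (hY : ∀ i, Measurable (Y i)) (n : ℕ) : Measurable (trainY Y n) :=
  measurable_pi_lambda _ fun i => hY (i + 1)

lemma pi_norm_le_sum_abs (y : Fin n → ℝ) : ‖y‖ ≤ ∑ i, |y i| :=
  (pi_norm_le_iff_of_nonneg (Finset.sum_nonneg fun i _ => abs_nonneg (y i))).2 fun i =>
    Finset.single_le_sum (f := fun i => |y i|) (fun i _ => abs_nonneg (y i)) (Finset.mem_univ i)

omit [IsProbabilityMeasure P] in
lemma memLp_norm_trainY (hY2 : ∀ i, MemLp (Y i) 2 P) (hY : ∀ i, Measurable (Y i)) (n : ℕ) :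
    MemLp (fun ω => ‖trainY Y n ω‖) 2 P := by
  have h : MemLp (fun ω => ∑ i : Fin n, |Y (i + 1) ω|) 2 P :=
    memLp_finsetSum _ fun i _ => (hY2 (i + 1)).abs
  refine h.mono (measurable_trainY hY n).norm.aestronglyMeasurable (Eventually.of_forall fun ω => ?_)
  rw [norm_norm]
  exact (pi_norm_le_sum_abs _).trans (le_abs_self _)

/-- The error at the unseen point of the average of the trees with bag `S`. -/
def bagError (q t : ℕ) (X : ℕ → Ω → Fin p → ℝ) (Y : ℕ → Ω → ℝ) (m : (Fin p → ℝ) → ℝ)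
    (S : {s : Finset (Fin n) // s.card = a}) (ω : Ω) : ℝ :=
  bagPredict q t S (trainX X n ω) (trainY Y n ω) (X 0 ω) - m (X 0 ω)

variable (hX : ∀ i, Measurable (X i)) (hY : ∀ i, Measurable (Y i)) (hm : Measurable m)
  (hindep : iIndepFun (fun i ω => (X i ω, Y i ω)) P)
  (hident : ∀ i, IdentDistrib (fun ω => (X i ω, Y i ω)) (fun ω => (X 0 ω, Y 0 ω)) P P)
  (hY2 : ∀ i, MemLp (Y i) 2 P) (hm2 : MemLp (fun ω => m (X 0 ω)) 2 P)

omit [IsProbabilityMeasure P] in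
include hX hY hY2 hm2 in
lemma memLp_bagError (S : {s : Finset (Fin n) // s.card = a}) :
    MemLp (bagError q t X Y m S) 2 P := by
  refine MemLp.sub ?_ hm2
  refine (memLp_norm_trainY hY2 hY n).mono (measurable_bagPredict (measurable_trainX hX n)
    (measurable_trainY hY n) (hX 0) S).aestronglyMeasurable (Eventually.of_forall fun ω => ?_)
  rw [norm_norm]
  exact abs_bagPredict_le _ _ _ _

include hX hY hm hindep hident hY2 hm2 in
-- The bags have equal size, so their private parts `S \ S'` and `S' \ S` are in bijection.
-- Enumerated compatibly, both errors become one function `Φ` of the common observations and of a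
-- private block, as `integral_mul_nonneg_of_shared` requires.
lemma integral_bagError_mul_nonneg (S S' : {s : Finset (Fin n) // s.card = a}) :
    0 ≤ ∫ ω, bagError q t X Y m S ω * bagError q t X Y m S' ω ∂P := by
  classical
  have hcard := Finset.card_sdiff_add_card_inter S.1 S'.1
  have hcard' := Finset.card_sdiff_add_card_inter S'.1 S.1
  rw [Finset.inter_comm S'.1 S.1] at hcard'
  have hS := S.2
  have hS' := S'.2
  let η : Fin a ≃ ↥(S.1 ∩ S'.1) ⊕ ↥(S.1 \ S'.1) := Fintype.equivOfCardEq (by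
    simp only [Fintype.card_fin, Fintype.card_sum, Fintype.card_coe]; omega)
  let e : ↥(S.1 \ S'.1) ≃ ↥(S'.1 \ S.1) := Fintype.equivOfCardEq (by
    simp only [Fintype.card_coe]; omega)
  let f : ↥(S.1 ∩ S'.1) ⊕ ↥(S.1 \ S'.1) → Fin n := Sum.elim Subtype.val Subtype.val
  let τ : Fin a ↪ Fin n := ⟨fun k => f (η k),
    Function.Injective.comp (Sum.elim_injective.2 ⟨Subtype.val_injective, Subtype.val_injective, by
      rintro ⟨c, hc⟩ ⟨d, hd⟩ rfl
      simp only [Finset.mem_inter, Finset.mem_sdiff] at hc hd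
      exact hd.2 hc.2⟩) η.injective⟩
  let f' : ↥(S.1 ∩ S'.1) ⊕ ↥(S.1 \ S'.1) → Fin n := Sum.elim Subtype.val (fun d => (e d).1)
  let τ' : Fin a ↪ Fin n := ⟨fun k => f' (η k),
    Function.Injective.comp (Sum.elim_injective.2 ⟨Subtype.val_injective,
      Subtype.val_injective.comp e.injective, by
        rintro ⟨c, hc⟩ d hd
        have hd' := (e d).2
        simp only [Finset.mem_inter, Finset.mem_sdiff] at hc hd'
        exact hd'.2 (hd ▸ hc.1)⟩) η.injective⟩
  have hτ : Finset.univ.map τ = S.1 := by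
    refine Finset.eq_of_subset_of_card_le (fun i hi => ?_) (by simp [hS])
    obtain ⟨k, -, rfl⟩ := Finset.mem_map.1 hi
    change f (η k) ∈ S.1
    rcases η k with c | d
    · exact (Finset.mem_inter.1 c.2).1
    · exact (Finset.mem_sdiff.1 d.2).1
  have hτ' : Finset.univ.map τ' = S'.1 := by
    refine Finset.eq_of_subset_of_card_le (fun i hi => ?_) (by simp [hS'])
    obtain ⟨k, -, rfl⟩ := Finset.mem_map.1 hi
    change f' (η k) ∈ S'.1
    rcases η k with c | d
    · exact (Finset.mem_inter.1 c.2).2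
    · exact (Finset.mem_sdiff.1 (e d).2).1
  -- `none` stands for the unseen observation `0`, at which both errors are evaluated and which is
  -- therefore shared; training indices are shifted by one.
  let u : Option ↥(S.1 ∩ S'.1) → ℕ := fun o => o.elim 0 fun c => (c.1 : ℕ) + 1
  let v : ↥(S.1 \ S'.1) → ℕ := fun d => (d.1 : ℕ) + 1
  let v' : ↥(S.1 \ S'.1) → ℕ := fun d => ((e d).1 : ℕ) + 1
  have hinj : Function.Injective (Sum.elim u (Sum.elim v v')) := by
    have hu : Function.Injective u := by
      rintro (_ | c) (_ | d) h
      · rfl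
      · simp [u] at h
      · simp [u] at h
      · simp only [u, Option.elim, add_left_inj] at h
        rw [Subtype.ext (Fin.ext h)]
    have hv : Function.Injective v := fun c d h => Subtype.ext (Fin.ext (by simpa [v] using h))
    have hv' : Function.Injective v' := fun c d h =>
      e.injective (Subtype.ext (Fin.ext (by simpa [v'] using h)))
    refine Sum.elim_injective.2 ⟨hu, Sum.elim_injective.2 ⟨hv, hv', ?_⟩, ?_⟩
    · intro c d h
      have hc := (Finset.mem_sdiff.1 c.2).1
      have hd := (Finset.mem_sdiff.1 (e d).2).2
      have : c.1 = (e d).1 := Fin.ext (by simpa [v, v'] using h)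
      exact hd (this ▸ hc)
    · rintro (_ | c) (d | d) h
      · simp [u, v] at h
      · simp [u, v'] at h
      · have hc := (Finset.mem_inter.1 c.2).2
        have hd := (Finset.mem_sdiff.1 d.2).2
        have : c.1 = d.1 := Fin.ext (by simpa [u, v] using h)
        exact hd (this ▸ hc)
      · have hc := (Finset.mem_inter.1 c.2).1
        have hd := (Finset.mem_sdiff.1 (e d).2).2
        have : c.1 = (e d).1 := Fin.ext (by simpa [u, v'] using h)
        exact hd (this ▸ hc)
  let w : (Option ↥(S.1 ∩ S'.1) → (Fin p → ℝ) × ℝ) × (↥(S.1 \ S'.1) → (Fin p → ℝ) × ℝ) →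
      Fin a → (Fin p → ℝ) × ℝ := fun A k => Sum.elim (fun c => A.1 (some c)) A.2 (η k)
  have hw : Measurable w := measurable_pi_lambda _ fun k => by
    simp only [w]
    rcases η k with c | d
    · exact (measurable_pi_apply _).comp measurable_fst
    · exact (measurable_pi_apply _).comp measurable_snd
  let Φ : (Option ↥(S.1 ∩ S'.1) → (Fin p → ℝ) × ℝ) × (↥(S.1 \ S'.1) → (Fin p → ℝ) × ℝ) → ℝ :=
    fun A => bagPredict q t (fullBag a) (fun k => (w A k).1) (fun k => (w A k).2) (A.1 none).1 -
      m (A.1 none).1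
  have hnone : Measurable fun A : (Option ↥(S.1 ∩ S'.1) → (Fin p → ℝ) × ℝ) ×
      (↥(S.1 \ S'.1) → (Fin p → ℝ) × ℝ) => (A.1 none).1 :=
    measurable_fst.comp ((measurable_pi_apply none).comp measurable_fst)
  have hΦ : Measurable Φ := (measurable_bagPredict (measurable_pi_lambda _ fun k =>
    measurable_fst.comp (measurable_pi_iff.1 hw k)) (measurable_pi_lambda _ fun k =>
    measurable_snd.comp (measurable_pi_iff.1 hw k)) hnone _).sub (hm.comp hnone)
  have e1 : ∀ ω, bagError q t X Y m S ω = Φ (fun i => (X (u i) ω, Y (u i) ω),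
      fun i => (X (v i) ω, Y (v i) ω)) := by
    intro ω
    simp only [bagError, Φ]
    rw [bagPredict_eq_comp τ S hτ]
    congr 2
    · ext1 k
      change X ((f (η k) : ℕ) + 1) ω = _
      simp only [w]
      rcases η k with c | d <;> rfl
    · ext1 k
      change Y ((f (η k) : ℕ) + 1) ω = _
      simp only [w]
      rcases η k with c | d <;> rfl
  have e2 : ∀ ω, bagError q t X Y m S' ω = Φ (fun i => (X (u i) ω, Y (u i) ω),
      fun i => (X (v' i) ω, Y (v' i) ω)) := by
    intro ω
    simp only [bagError, Φ]
    rw [bagPredict_eq_comp τ' S' hτ']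
    congr 2
    · ext1 k
      change X ((f' (η k) : ℕ) + 1) ω = _
      simp only [w]
      rcases η k with c | d <;> rfl
    · ext1 k
      change Y ((f' (η k) : ℕ) + 1) ω = _
      simp only [w]
      rcases η k with c | d <;> rfl
  have hint := (memLp_bagError (q := q) (t := t) hX hY hY2 hm2 S).integrable_mul
    (memLp_bagError (q := q) (t := t) hX hY hY2 hm2 S')
  have hint' := hint.congr (Eventually.of_forall fun ω => by
    rw [Pi.mul_apply, e1 ω, e2 ω])
  have h := integral_mul_nonneg_of_shared (fun i => (hX i).prodMk (hY i)) hindep hident hinj hΦ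
    hint'
  simpa only [e1, e2] using h

include hX hY hm hindep hident in
/-- Exchanging a training point with the unseen point. -/
lemma integral_oobMean_sub_sq (i : Fin n) :
    ∫ ω, (oobMean a q t (trainX X n ω) (trainY Y n ω) i - m (X (i + 1) ω)) ^ 2 ∂P =
      ∫ ω, ((∑ S : {s : Finset (Fin n) // s.card = a} with i ∉ S.1,
          bagPredict q t S (trainX X n ω) (trainY Y n ω) (X 0 ω)) /
        ((Finset.univ.filter fun S : {s : Finset (Fin n) // s.card = a} => i ∉ S.1).card : ℝ)
          - m (X 0 ω)) ^ 2 ∂P := by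
  let H : (Option (Fin n) → (Fin p → ℝ) × ℝ) → ℝ := fun w =>
    ((∑ S : {s : Finset (Fin n) // s.card = a} with i ∉ S.1,
        bagPredict q t S (fun j => (w (some j)).1) (fun j => (w (some j)).2) (w none).1) /
      ((Finset.univ.filter fun S : {s : Finset (Fin n) // s.card = a} => i ∉ S.1).card : ℝ)
        - m (w none).1) ^ 2
  have hH : Measurable H := by
    have hc : ∀ o : Option (Fin n), Measurable fun w : Option (Fin n) → (Fin p → ℝ) × ℝ =>
        (w o).1 := fun o => measurable_fst.comp (measurable_pi_apply o)
    refine (((Finset.measurable_sum _ fun S _ => measurable_bagPredict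
      (measurable_pi_lambda _ fun j => hc (some j)) (measurable_pi_lambda _ fun j =>
        measurable_snd.comp (measurable_pi_apply (some j))) (hc none) S).div_const _).sub
          (hm.comp (hc none))).pow_const 2
  let τ : Option (Fin n) → ℕ := fun o => o.elim 0 fun j => (j : ℕ) + 1
  have hτ : Function.Injective τ := by
    rintro (_ | c) (_ | d) h
    · rfl
    · simp [τ] at h
    · simp [τ] at h
    · simp only [τ, Option.elim, add_left_inj] at h
      rw [Fin.ext h]
  -- The transposition preserves the joint law. It moves the evaluation point, but no observation
  -- used by a tree whose bag avoids `i`.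
  have hτ' : Function.Injective (Equiv.swap 0 ((i : ℕ) + 1) ∘ τ) :=
    (Equiv.injective _).comp hτ
  have hmeas : ∀ i, Measurable fun ω => (X i ω, Y i ω) := fun i => (hX i).prodMk (hY i)
  have h1 := map_injective_eq_pi hmeas hindep hident hτ
  have h2 := map_injective_eq_pi hmeas hindep hident hτ'
  have hval : ∀ σ : Option (Fin n) → ℕ, ∫ ω, H (fun k => (X (σ k) ω, Y (σ k) ω)) ∂P =
      ∫ w, H w ∂P.map (fun ω k => (X (σ k) ω, Y (σ k) ω)) := fun σ =>
    (integral_map (measurable_pi_lambda _ fun k => hmeas (σ k)).aemeasurable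
      hH.aestronglyMeasurable).symm
  have key := (hval (Equiv.swap 0 ((i : ℕ) + 1) ∘ τ)).trans ((congrArg (fun ν => ∫ w, H w ∂ν)
    (h2.trans h1.symm)).trans (hval τ).symm)
  refine Eq.trans ?_ key
  refine integral_congr_ae (Eventually.of_forall fun ω => ?_)
  simp only [H, oobMean_eq_bag]
  have hnone : (Equiv.swap 0 ((i : ℕ) + 1) ∘ τ) none = i + 1 := by simp [τ]
  have hsome : ∀ j : Fin n, j ≠ i → (Equiv.swap 0 ((i : ℕ) + 1) ∘ τ) (some j) = j + 1 := by
    intro j hj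
    simp only [Function.comp_apply, τ, Option.elim]
    exact Equiv.swap_apply_of_ne_of_ne (by omega) fun h => hj (Fin.ext (by omega))
  rw [hnone]
  congr 3
  refine Finset.sum_congr rfl fun S hS => ?_
  have hiS : i ∉ S.1 := (Finset.mem_filter.1 hS).2
  refine bagPredict_congr S (fun j hj => ?_) (fun j hj => ?_) _
  · rw [hsome j (fun h => hiS (h ▸ hj))]; rfl
  · rw [hsome j (fun h => hiS (h ▸ hj))]; rfl

omit [IsProbabilityMeasure P] in
lemma integral_sum_sq {ι : Type*} (I : Finset ι) {g : ι → Ω → ℝ} (hg : ∀ i, MemLp (g i) 2 P) :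
    ∫ ω, (∑ i ∈ I, g i ω) ^ 2 ∂P = ∑ i ∈ I, ∑ j ∈ I, ∫ ω, g i ω * g j ω ∂P := by
  simp only [sq, Finset.sum_mul_sum]
  have hint : ∀ i j, Integrable (fun ω => g i ω * g j ω) P := fun i j =>
    (hg i).integrable_mul (hg j)
  rw [integral_finsetSum _ fun i _ => integrable_finsetSum _ fun j _ => hint i j]
  exact Finset.sum_congr rfl fun i _ => integral_finsetSum _ fun j _ => hint i j

include hX hY hm hindep hident hY2 hm2 in
/-- The average squared error of the infinite out-of-bag predictions is at most `n / (n - a)` times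
the squared error of the infinite forest at an unseen point. -/
lemma sum_integral_oobMean_sub_sq_le (ha : a < n) :
    ∑ i : Fin n, ∫ ω, (oobMean a q t (trainX X n ω) (trainY Y n ω) i - m (X (i + 1) ω)) ^ 2 ∂P ≤
      (n : ℝ) ^ 2 / (n - a) *
        ∫ ω, (meanPredict a q t (trainX X n ω) (trainY Y n ω) (X 0 ω) - m (X 0 ω)) ^ 2 ∂P := by
  classical
  set e : {s : Finset (Fin n) // s.card = a} → {s : Finset (Fin n) // s.card = a} → ℝ :=
    fun S S' => ∫ ω, bagError q t X Y m S ω * bagError q t X Y m S' ω ∂P with he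
  have hmem := fun S : {s : Finset (Fin n) // s.card = a} =>
    memLp_bagError (q := q) (t := t) hX hY hY2 hm2 S
  have hN : (0 : ℝ) < n.choose a := by exact_mod_cast Nat.choose_pos ha.le
  have hN' : (0 : ℝ) < (n - 1).choose a := by exact_mod_cast Nat.choose_pos (by omega)
  -- The fraction `(n - a) / n` of bags avoiding a given point; together with the count `n - a` of
  -- indices per pair it yields `n ^ 2 / (n - a)`.
  have hrel : ((n - 1).choose a : ℝ) * n = n.choose a * (n - a) := by
    obtain ⟨k, rfl⟩ : ∃ k, n = k + 1 := ⟨n - 1, by omega⟩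
    have h := Nat.choose_mul_succ_eq k a
    have h' : ((k.choose a * (k + 1) : ℕ) : ℝ) = (((k + 1).choose a * (k + 1 - a) : ℕ) : ℝ) := by
      rw [h]
    rw [Nat.cast_mul, Nat.cast_mul, Nat.cast_sub ha.le] at h'
    exact h'
  have h1 : ∀ i : Fin n,
      ∫ ω, (oobMean a q t (trainX X n ω) (trainY Y n ω) i - m (X (i + 1) ω)) ^ 2 ∂P =
        (1 / ((n - 1).choose a : ℝ) ^ 2) *
          ∑ S : {s : Finset (Fin n) // s.card = a} with ¬ i ∈ S.1,
            ∑ S' : {s : Finset (Fin n) // s.card = a} with ¬ i ∈ S'.1, e S S' := by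
    intro i
    rw [integral_oobMean_sub_sq hX hY hm hindep hident, he, ← integral_sum_sq _ hmem,
      ← integral_const_mul]
    refine integral_congr_ae (Eventually.of_forall fun ω => ?_)
    simp only [bagError]
    rw [Finset.sum_sub_distrib, Finset.sum_const, card_bag_notMem, nsmul_eq_mul]
    field_simp
  have h2 : ∫ ω, (meanPredict a q t (trainX X n ω) (trainY Y n ω) (X 0 ω) - m (X 0 ω)) ^ 2 ∂P =
      (1 / (n.choose a : ℝ) ^ 2) * ∑ S, ∑ S', e S S' := by
    rw [he, ← integral_sum_sq _ hmem, ← integral_const_mul]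
    refine integral_congr_ae (Eventually.of_forall fun ω => ?_)
    simp only [bagError, meanPredict_eq_bag]
    rw [Finset.sum_sub_distrib, Finset.sum_const, Finset.card_univ, card_bag, nsmul_eq_mul]
    field_simp
  have h3 := sum_filter_card_le (fun (i : Fin n) (S : {s : Finset (Fin n) // s.card = a}) =>
    i ∈ S.1) ha.le (fun S => by simpa using S.2) e fun S S' =>
      integral_bagError_mul_nonneg hX hY hm hindep hident hY2 hm2 S S'
  have hna : (0 : ℝ) < n - a := sub_pos.2 (by exact_mod_cast ha)
  simp only [h1, h2]
  rw [← Finset.mul_sum]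
  calc (1 / ((n - 1).choose a : ℝ) ^ 2) * _ ≤
        (1 / ((n - 1).choose a : ℝ) ^ 2) * (((n : ℝ) - a) * ∑ S, ∑ S', e S S') :=
        mul_le_mul_of_nonneg_left h3 (by positivity)
    _ = (n : ℝ) ^ 2 / (n - a) * ((1 / (n.choose a : ℝ) ^ 2) * ∑ S, ∑ S', e S S') := by
        have hn : (n : ℝ) ≠ 0 := by
          have : 0 < n := by omega
          positivity
        have : (n.choose a : ℝ) = (n - 1).choose a * n / (n - a) := by
          rw [hrel]; field_simp
        rw [this]
        field_simp

end Comparison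

/-! ### Residual variance estimators: bounds, limits and measurability -/

lemma residualVar_nonneg (y pred : Fin n → ℝ) : 0 ≤ residualVar y pred :=
  mul_nonneg (by positivity) (Finset.sum_nonneg fun i _ => sq_nonneg _)

lemma residualVar_le {y pred : Fin n → ℝ} (h : ∀ i, |pred i| ≤ ‖y‖) :
    residualVar y pred ≤ 4 * ‖y‖ ^ 2 := by
  have h1 : ∀ i, (y i - pred i) ^ 2 ≤ 4 * ‖y‖ ^ 2 := by
    intro i
    have h2 : |y i - pred i| ≤ 2 * ‖y‖ := by
      have h3 : |y i| ≤ ‖y‖ := norm_le_pi_norm y i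
      have := abs_sub (y i) (pred i)
      linarith [h i]
    have := sq_le_sq' (abs_le.1 h2).1 (abs_le.1 h2).2
    linarith
  have h2 : ∑ i, (y i - pred i) ^ 2 ≤ n * (4 * ‖y‖ ^ 2) := by
    simpa using Finset.sum_le_sum fun i (_ : i ∈ Finset.univ) => h1 i
  rw [residualVar, one_div, inv_mul_eq_div]
  exact div_le_of_le_mul₀ (Nat.cast_nonneg _) (by positivity) (by linarith)

lemma iSup_abs_eq_norm [NeZero n] (v : Fin n → ℝ) : ⨆ i, |v i| = ‖v‖ := by
  refine le_antisymm (ciSup_le fun i => norm_le_pi_norm v i) ?_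
  exact (pi_norm_le_iff_of_nonempty _).2 fun i =>
    le_ciSup (f := fun i => |v i|) (Set.finite_range _).bddAbove i

/-- The constant is `4 + 8 * (1 + 4 * (1 + 4 * log n))`, from `8 / M ≤ 8` and `residualVar ≤ 4 * ‖y‖
^ 2`. It may grow with `n` but not with `M`, which suffices as `M → ∞` is taken first. -/
lemma abs_residualVarCorrected_le [NeZero n] {M : ℕ} (hM : 1 ≤ M) {y pred : Fin n → ℝ}
    (h : ∀ i, |pred i| ≤ ‖y‖) :
    |residualVarCorrected M y pred| ≤ (44 + 128 * Real.log n) * ‖y‖ ^ 2 := by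
  have h1 := residualVar_nonneg y pred
  have h2 := residualVar_le h
  have h3 : ‖pred‖ ^ 2 ≤ ‖y‖ ^ 2 :=
    pow_le_pow_left₀ (norm_nonneg _) ((pi_norm_le_iff_of_nonneg (norm_nonneg _)).2 h) 2
  have hlog : 0 ≤ Real.log n := Real.log_natCast_nonneg n
  have h4 : (8 : ℝ) / M ≤ 8 := div_le_self (by norm_num) (by exact_mod_cast hM)
  have h5 : 0 ≤ ‖pred‖ ^ 2 + residualVar y pred * (1 + 4 * Real.log n) := by positivity
  have h6 : residualVar y pred * (1 + 4 * Real.log n) ≤ 4 * ‖y‖ ^ 2 * (1 + 4 * Real.log n) := by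
    gcongr
  have h7 : 8 / (M : ℝ) * (‖pred‖ ^ 2 + residualVar y pred * (1 + 4 * Real.log n)) ≤
      8 * (‖pred‖ ^ 2 + residualVar y pred * (1 + 4 * Real.log n)) := by gcongr
  have h8 : 0 ≤ 8 / (M : ℝ) * (‖pred‖ ^ 2 + residualVar y pred * (1 + 4 * Real.log n)) := by
    positivity
  rw [residualVarCorrected, iSup_abs_eq_norm, abs_abs, abs_le]
  constructor <;> nlinarith

lemma tendsto_residualVar {y : Fin n → ℝ} {pred : ℕ → Fin n → ℝ} {v : Fin n → ℝ}
    (h : ∀ i, Tendsto (fun M => pred M i) atTop (𝓝 (v i))) :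
    Tendsto (fun M => residualVar y (pred M)) atTop (𝓝 (residualVar y v)) :=
  (tendsto_finsetSum _ fun i _ => (tendsto_const_nhds.sub (h i)).pow 2).const_mul _

/-- For fixed `n` the bracket converges and its factor `8 / M` kills it; the outer absolute value is
harmless since the limit is nonnegative. -/
lemma tendsto_residualVarCorrected [NeZero n] {y : Fin n → ℝ} {pred : ℕ → Fin n → ℝ}
    {v : Fin n → ℝ} (h : ∀ i, Tendsto (fun M => pred M i) atTop (𝓝 (v i))) :
    Tendsto (fun M => residualVarCorrected M y (pred M)) atTop (𝓝 (residualVar y v)) := by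
  have h1 := tendsto_residualVar (y := y) h
  have h2 : Tendsto (fun M => ‖pred M‖ ^ 2) atTop (𝓝 (‖v‖ ^ 2)) :=
    ((tendsto_pi_nhds.2 h).norm).pow 2
  have h3 := (h1.sub ((tendsto_const_div_atTop_nhds_zero_nat 8).mul
    (h2.add (h1.mul_const (1 + 4 * Real.log n))))).abs
  rw [zero_mul, sub_zero, abs_of_nonneg (residualVar_nonneg y v)] at h3
  refine h3.congr fun M => ?_
  rw [residualVarCorrected, iSup_abs_eq_norm]

section Measurability

variable {δ : Type*} [MeasurableSpace δ] {y pred : δ → Fin n → ℝ}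

lemma measurable_residualVar (hy : Measurable y) (hp : ∀ i, Measurable fun d => pred d i) :
    Measurable fun d => residualVar (y d) (pred d) :=
  (Finset.measurable_sum _ fun i _ =>
    ((measurable_pi_iff.1 hy i).sub (hp i)).pow_const 2).const_mul _

lemma measurable_residualVarCorrected [NeZero n] (M : ℕ) (hy : Measurable y)
    (hp : ∀ i, Measurable fun d => pred d i) :
    Measurable fun d => residualVarCorrected M (y d) (pred d) := by
  have h1 := measurable_residualVar hy hp
  have h2 : Measurable fun d => ‖pred d‖ := (measurable_pi_iff.2 hp).norm
  simp only [residualVarCorrected, iSup_abs_eq_norm]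
  exact (h1.sub (((h2.pow_const 2).add (h1.mul_const _)).const_mul _)).abs

end Measurability

/-! ### Consistency under the sequential limit -/

section Consistency

variable {Ω : Type*} [MeasurableSpace Ω] {P : Measure Ω} [IsProbabilityMeasure P]

/-- Dominated convergence in `M` for each `n` identifies the inner limit as `E|V n - c|`, leaving a
single limit in `n`. -/
lemma seqL1Consistent_of_dominated {T : ℕ → ℕ → Ω → ℝ} {V : ℕ → Ω → ℝ} {c : ℝ}
    {g : ℕ → Ω → ℝ} (hT : ∀ n ≥ 2, ∀ M ≥ 1, AEStronglyMeasurable (T n M) P)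
    (hg : ∀ n ≥ 2, Integrable (g n) P) (hbound : ∀ n ≥ 2, ∀ M ≥ 1, ∀ ω, |T n M ω| ≤ g n ω)
    (hlim : ∀ n ≥ 2, ∀ᵐ ω ∂P, Tendsto (fun M => T n M ω) atTop (𝓝 (V n ω)))
    (hV : Tendsto (fun n => ∫ ω, |V n ω - c| ∂P) atTop (𝓝 0)) : SeqL1Consistent P T c := by
  refine ⟨fun n hn M hM => (hg n hn).mono' (hT n hn M hM)
    (Eventually.of_forall fun ω => hbound n hn M hM ω), fun n => ∫ ω, |V n ω - c| ∂P,
    fun n hn => ?_, hV⟩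
  refine tendsto_integral_filter_of_dominated_convergence (fun ω => g n ω + |c|) ?_ ?_
    ((hg n hn).add (integrable_const _)) ?_
  · filter_upwards [eventually_ge_atTop 1] with M hM
    exact ((hT n hn M hM).sub aestronglyMeasurable_const).norm
  · filter_upwards [eventually_ge_atTop 1] with M hM
    refine Eventually.of_forall fun ω => ?_
    rw [Real.norm_eq_abs, abs_abs]
    exact (abs_sub _ _).trans (add_le_add (hbound n hn M hM ω) le_rfl)
  · filter_upwards [hlim n hn] with ω hω
    exact (hω.sub_const c).abs

/-- The law of large numbers in `L₁` for the squares of the errors. -/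
lemma tendsto_integral_abs_avg_sq_sub {ε : ℕ → Ω → ℝ} {σ : ℝ} (hε_indep : iIndepFun ε P)
    (hε_ident : ∀ i, IdentDistrib (ε i) (ε 0) P P) (hε_sq : MemLp (ε 0) 2 P)
    (hvar : ∫ ω, ε 0 ω ^ 2 ∂P = σ ^ 2) :
    Tendsto (fun n : ℕ => ∫ ω, |1 / (n : ℝ) * ∑ i : Fin n, ε (i + 1) ω ^ 2 - σ ^ 2| ∂P) atTop
      (𝓝 0) := by
  have hsq : Measurable fun x : ℝ => x ^ 2 := measurable_id.pow_const 2
  have hid : ∀ i, IdentDistrib (fun ω => ε i ω ^ 2) (fun ω => ε 0 ω ^ 2) P P :=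
    fun i => (hε_ident i).comp hsq
  have hmean : ∫ ω, ε (0 + 1) ω ^ 2 ∂P = σ ^ 2 := (hid 1).integral_eq.trans hvar
  have h := strong_law_Lp (μ := P) (p := 1) le_rfl ENNReal.one_ne_top
    (fun i ω => ε (i + 1) ω ^ 2)
    (memLp_one_iff_integrable.2 ((hid 1).integrable_iff.2 hε_sq.integrable_sq))
    (fun i j hij => (hε_indep.indepFun (by simpa using hij)).comp hsq hsq)
    (fun i => (hid (i + 1)).trans (hid 1).symm)
  have h' := (ENNReal.tendsto_toReal ENNReal.zero_ne_top).comp h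
  rw [ENNReal.toReal_zero] at h'
  refine h'.congr fun n => ?_
  have hint : ∀ i, Integrable (fun ω => ε i ω ^ 2) P := fun i =>
    (hid i).integrable_iff.2 hε_sq.integrable_sq
  have hm : AEStronglyMeasurable (fun ω => 1 / (n : ℝ) * ∑ i : Fin n, ε (i + 1) ω ^ 2 - σ ^ 2) P :=
    (((integrable_finsetSum _ fun i _ => hint _).const_mul _).sub
      (integrable_const _)).aestronglyMeasurable
  have e := integral_norm_eq_lintegral_enorm hm
  simp only [Real.norm_eq_abs] at e
  rw [e, Function.comp_apply, eLpNorm_one_eq_lintegral_enorm]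
  simp only [Finset.sum_range, hmean, smul_eq_mul, one_div]

/-- Young's inequality `|2 * e * r| ≤ η * e ^ 2 + r ^ 2 / η` on the cross term. A small `η` tames
the noise part, whose mean square does not vanish, while the prediction error absorbs the large `1 /
η`. -/
lemma abs_residualVar_sub_le {y pred e r : Fin n → ℝ} (h : ∀ i, y i - pred i = e i + r i)
    {c η : ℝ} (hη : 0 < η) :
    |residualVar y pred - c| ≤ |1 / (n : ℝ) * ∑ i, e i ^ 2 - c| +
      1 / (n : ℝ) * (η * ∑ i, e i ^ 2 + (1 + 1 / η) * ∑ i, r i ^ 2) := by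
  have e1 : residualVar y pred - c = (1 / (n : ℝ) * ∑ i, e i ^ 2 - c) +
      1 / (n : ℝ) * ∑ i, (2 * e i * r i + r i ^ 2) := by
    simp only [residualVar, h, add_sq, Finset.sum_add_distrib]
    ring
  have h2 : |∑ i, (2 * e i * r i + r i ^ 2)| ≤
      η * ∑ i, e i ^ 2 + (1 + 1 / η) * ∑ i, r i ^ 2 := by
    rw [Finset.mul_sum, Finset.mul_sum, ← Finset.sum_add_distrib]
    refine (Finset.abs_sum_le_sum_abs _ _).trans (Finset.sum_le_sum fun i _ => ?_)
    have k1 : 0 ≤ (η * e i + r i) ^ 2 / η := by positivity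
    have k2 : 0 ≤ (η * e i - r i) ^ 2 / η := by positivity
    have k3 : (η * e i + r i) ^ 2 / η = η * e i ^ 2 + 2 * e i * r i + 1 / η * r i ^ 2 := by
      field_simp; ring
    have k4 : (η * e i - r i) ^ 2 / η = η * e i ^ 2 - 2 * e i * r i + 1 / η * r i ^ 2 := by
      field_simp; ring
    rw [abs_le]
    constructor <;> nlinarith [sq_nonneg (r i)]
  rw [e1]
  refine (abs_add_le _ _).trans (add_le_add le_rfl ?_)
  rw [abs_mul, abs_of_nonneg (by positivity : (0 : ℝ) ≤ 1 / n)]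
  gcongr

/-- If the predictions are consistent on average, then the residual variance is consistent. -/
lemma tendsto_integral_abs_residualVar_sub {ε Y : ℕ → Ω → ℝ} {σ : ℝ}
    (hε_indep : iIndepFun ε P) (hε_ident : ∀ i, IdentDistrib (ε i) (ε 0) P P)
    (hε_sq : MemLp (ε 0) 2 P) (hvar : ∫ ω, ε 0 ω ^ 2 ∂P = σ ^ 2)
    {pred r : (n : ℕ) → Ω → Fin n → ℝ}
    (hr : ∀ n ω (i : Fin n), trainY Y n ω i - pred n ω i = ε (i + 1) ω + r n ω i)
    (hr2 : ∀ n i, MemLp (fun ω => r n ω i) 2 P)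
    (hR : Tendsto (fun n : ℕ => 1 / (n : ℝ) * ∑ i : Fin n, ∫ ω, r n ω i ^ 2 ∂P) atTop (𝓝 0)) :
    Tendsto (fun n => ∫ ω, |residualVar (trainY Y n ω) (pred n ω) - σ ^ 2| ∂P) atTop (𝓝 0) := by
  have hA := tendsto_integral_abs_avg_sq_sub hε_indep hε_ident hε_sq hvar
  have hsq : Measurable fun x : ℝ => x ^ 2 := measurable_id.pow_const 2
  have hid : ∀ i, IdentDistrib (fun ω => ε i ω ^ 2) (fun ω => ε 0 ω ^ 2) P P :=
    fun i => (hε_ident i).comp hsq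
  have hint : ∀ i, Integrable (fun ω => ε i ω ^ 2) P := fun i =>
    (hid i).integrable_iff.2 hε_sq.integrable_sq
  have hmean : ∀ i, ∫ ω, ε i ω ^ 2 ∂P = σ ^ 2 := fun i => (hid i).integral_eq.trans hvar
  have hbound : ∀ η > 0, ∀ n : ℕ,
      ∫ ω, |residualVar (trainY Y n ω) (pred n ω) - σ ^ 2| ∂P ≤
        ∫ ω, |1 / (n : ℝ) * ∑ i : Fin n, ε (i + 1) ω ^ 2 - σ ^ 2| ∂P + η * σ ^ 2 +
          (1 + 1 / η) * (1 / (n : ℝ) * ∑ i : Fin n, ∫ ω, r n ω i ^ 2 ∂P) := by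
    intro η hη n
    have i0 : Integrable (fun ω => ∑ i : Fin n, ε (i + 1) ω ^ 2) P :=
      integrable_finsetSum _ fun i _ => hint _
    have i1 : Integrable (fun ω => |1 / (n : ℝ) * ∑ i : Fin n, ε (i + 1) ω ^ 2 - σ ^ 2|) P :=
      ((i0.const_mul _).sub (integrable_const _)).abs
    have i2 : Integrable (fun ω => ∑ i : Fin n, r n ω i ^ 2) P :=
      integrable_finsetSum _ fun i _ => (hr2 n i).integrable_sq
    have i3 : Integrable (fun ω => 1 / (n : ℝ) * (η * ∑ i : Fin n, ε (i + 1) ω ^ 2 +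
        (1 + 1 / η) * ∑ i, r n ω i ^ 2)) P :=
      ((i0.const_mul _).add (i2.const_mul _)).const_mul _
    calc ∫ ω, |residualVar (trainY Y n ω) (pred n ω) - σ ^ 2| ∂P
        ≤ ∫ ω, (|1 / (n : ℝ) * ∑ i : Fin n, ε (i + 1) ω ^ 2 - σ ^ 2| +
            1 / (n : ℝ) * (η * ∑ i : Fin n, ε (i + 1) ω ^ 2 +
              (1 + 1 / η) * ∑ i, r n ω i ^ 2)) ∂P :=
          integral_mono_of_nonneg (Eventually.of_forall fun ω => abs_nonneg _) (i1.add i3)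
            (Eventually.of_forall fun ω => abs_residualVar_sub_le (hr n ω) hη)
      _ = ∫ ω, |1 / (n : ℝ) * ∑ i : Fin n, ε (i + 1) ω ^ 2 - σ ^ 2| ∂P +
            1 / (n : ℝ) * (η * ∑ i : Fin n, σ ^ 2 +
              (1 + 1 / η) * ∑ i : Fin n, ∫ ω, r n ω i ^ 2 ∂P) := by
          rw [integral_add i1 i3, integral_const_mul,
            integral_add (i0.const_mul _) (i2.const_mul _), integral_const_mul,
            integral_const_mul, integral_finsetSum _ fun i _ => hint _,
            integral_finsetSum _ fun i _ => (hr2 n i).integrable_sq]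
          simp only [hmean]
      _ ≤ _ := by
          rw [Finset.sum_const, Finset.card_univ, Fintype.card_fin, nsmul_eq_mul]
          have : 1 / (n : ℝ) * (η * (n * σ ^ 2)) ≤ η * σ ^ 2 := by
            rcases Nat.eq_zero_or_pos n with rfl | hn
            · simp only [Nat.cast_zero, div_zero, zero_mul]; positivity
            · have : (n : ℝ) ≠ 0 := by positivity
              apply le_of_eq
              field_simp
          linarith
  refine tendsto_order.2 ⟨fun c hc => Eventually.of_forall fun n =>
    hc.trans_le (integral_nonneg fun ω => abs_nonneg _), fun c hc => ?_⟩
  obtain ⟨η, hη, hηc⟩ : ∃ η > 0, η * σ ^ 2 < c := by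
    -- The added `1` gives strict inequality and avoids a division by `σ ^ 2`.
    refine ⟨c / (σ ^ 2 + 1), by positivity, ?_⟩
    rw [div_mul_eq_mul_div, div_lt_iff₀ (by positivity)]
    nlinarith
  have hlim := (hA.add_const (η * σ ^ 2)).add (hR.const_mul (1 + 1 / η))
  rw [mul_zero, add_zero, zero_add] at hlim
  filter_upwards [hlim.eventually_lt_const hηc] with n hn
  exact (hbound η hη n).trans_lt hn

end Consistency

/-! ### Gaussian errors -/

/-- The weight cancels half of the Gaussian exponent, leaving an unnormalized Gaussian of variance
`2 * σ ^ 2`, hence the ratio `√2` of standard deviations. -/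
lemma integral_exp_sq_gaussianReal {σ : ℝ} (hσ : 0 < σ) :
    Integrable (fun x => Real.exp (x ^ 2 / (4 * σ ^ 2)))
        (gaussianReal 0 (Real.toNNReal (σ ^ 2))) ∧
      ∫ x, Real.exp (x ^ 2 / (4 * σ ^ 2)) ∂gaussianReal 0 (Real.toNNReal (σ ^ 2)) = √2 := by
  have hv : Real.toNNReal (σ ^ 2) ≠ 0 := by
    rw [Ne, Real.toNNReal_eq_zero, not_le]; positivity
  have hb : (0 : ℝ) < 1 / (4 * σ ^ 2) := by positivity
  have e : ∀ x, gaussianPDFReal 0 (Real.toNNReal (σ ^ 2)) x * Real.exp (x ^ 2 / (4 * σ ^ 2)) =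
      (√(2 * Real.pi * σ ^ 2))⁻¹ * Real.exp (-(1 / (4 * σ ^ 2)) * x ^ 2) := by
    intro x
    rw [gaussianPDFReal, Real.coe_toNNReal _ (sq_nonneg σ), mul_assoc, ← Real.exp_add]
    congr 2
    field_simp
    ring
  constructor
  · rw [gaussianReal_of_var_ne_zero 0 hv, integrable_withDensity_iff_integrable_smul'
      (measurable_gaussianPDF _ _) (by simp [gaussianPDF])]
    simp only [toReal_gaussianPDF, smul_eq_mul, e]
    exact (integrable_exp_neg_mul_sq hb).const_mul _
  · rw [integral_gaussianReal_eq_integral_smul hv]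
    simp only [smul_eq_mul, e]
    rw [integral_const_mul, integral_gaussian, ← Real.sqrt_inv,
      ← Real.sqrt_mul (by positivity)]
    congr 1
    have := Real.pi_pos.ne'
    field_simp
    norm_num

/-- At the index of the largest response put `u = e ^ 2 / (4 * σ ^ 2)`. Then `u - log n + 1 ≤ exp (u
- log n) = exp u / n`, which is at most the average of all the exponentials. This trades a maximum
for an average at the price of `log n`. -/
lemma norm_sq_le_of_sum_exp [NeZero n] {y μ e : Fin n → ℝ} (hy : ∀ i, y i = μ i + e i) {B σ : ℝ}
    (hσ : 0 < σ) (hμ : ∀ i, |μ i| ≤ B) :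
    ‖y‖ ^ 2 ≤ 2 * B ^ 2 + 8 * σ ^ 2 * (Real.log n - 1 +
      1 / (n : ℝ) * ∑ i, Real.exp (e i ^ 2 / (4 * σ ^ 2))) := by
  obtain ⟨i, -, hi⟩ := Finset.exists_mem_eq_sup' (Finset.univ_nonempty (α := Fin n))
    fun i => |y i|
  have hnorm : ‖y‖ ≤ |y i| := by
    rw [← hi]
    exact (pi_norm_le_iff_of_nonempty _).2 fun j =>
      Finset.le_sup' (fun i => |y i|) (Finset.mem_univ j)
  have hn : (0 : ℝ) < n := by exact_mod_cast Nat.pos_of_ne_zero (NeZero.ne n)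
  have h1 : ‖y‖ ^ 2 ≤ y i ^ 2 := by
    rw [← sq_abs (y i)]
    exact pow_le_pow_left₀ (norm_nonneg _) hnorm 2
  have h2 : y i ^ 2 ≤ 2 * μ i ^ 2 + 2 * e i ^ 2 := by
    rw [hy i]
    nlinarith [sq_nonneg (μ i - e i)]
  have h3 : μ i ^ 2 ≤ B ^ 2 := sq_le_sq.2 ((hμ i).trans (le_abs_self B))
  have h4 : e i ^ 2 / (4 * σ ^ 2) - Real.log n + 1 ≤
      1 / (n : ℝ) * Real.exp (e i ^ 2 / (4 * σ ^ 2)) := by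
    have := Real.add_one_le_exp (e i ^ 2 / (4 * σ ^ 2) - Real.log n)
    rw [Real.exp_sub, Real.exp_log hn] at this
    rwa [one_div, inv_mul_eq_div]
  have h5 : 1 / (n : ℝ) * Real.exp (e i ^ 2 / (4 * σ ^ 2)) ≤
      1 / (n : ℝ) * ∑ i, Real.exp (e i ^ 2 / (4 * σ ^ 2)) := by
    gcongr
    exact Finset.single_le_sum (f := fun i => Real.exp (e i ^ 2 / (4 * σ ^ 2)))
      (fun i _ => (Real.exp_pos _).le) (Finset.mem_univ i)
  have h6 : e i ^ 2 = 4 * σ ^ 2 * (e i ^ 2 / (4 * σ ^ 2)) := by field_simp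
  have h7 : e i ^ 2 / (4 * σ ^ 2) ≤ Real.log n - 1 +
      1 / (n : ℝ) * ∑ i, Real.exp (e i ^ 2 / (4 * σ ^ 2)) := by linarith
  have h8 := mul_le_mul_of_nonneg_left h7 (by positivity : 0 ≤ 8 * σ ^ 2)
  linarith

section Gaussian

variable {Ω : Type*} [MeasurableSpace Ω] {P : Measure Ω} [IsProbabilityMeasure P]

lemma integral_norm_trainY_sq_le {X : ℕ → Ω → Fin p → ℝ} {ε Y : ℕ → Ω → ℝ}
    {m : (Fin p → ℝ) → ℝ} {σ B : ℝ} (hσ : 0 < σ) (hε_meas : ∀ i, Measurable (ε i))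
    (hε_ident : ∀ i, IdentDistrib (ε i) (ε 0) P P)
    (hgauss : P.map (ε 0) = gaussianReal 0 (Real.toNNReal (σ ^ 2)))
    (hY : ∀ i ω, Y i ω = m (X i ω) + ε i ω) (hB : ∀ᵐ ω ∂P, ∀ i, |m (X i ω)| ≤ B) (hn : 2 ≤ n) :
    ∫ ω, ‖trainY Y n ω‖ ^ 2 ∂P ≤ 8 * (B ^ 2 + σ ^ 2 * (1 + 4 * Real.log n)) := by
  have : NeZero n := ⟨by omega⟩
  obtain ⟨hi, he⟩ := integral_exp_sq_gaussianReal hσ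
  have hmap : ∀ i, P.map (ε i) = gaussianReal 0 (Real.toNNReal (σ ^ 2)) := fun i =>
    (hε_ident i).map_eq.trans hgauss
  have hexp : Measurable fun x : ℝ => Real.exp (x ^ 2 / (4 * σ ^ 2)) := by fun_prop
  have hint : ∀ i, Integrable (fun ω => Real.exp (ε i ω ^ 2 / (4 * σ ^ 2))) P := fun i => by
    rw [← hmap i] at hi
    exact hi.comp_measurable (hε_meas i)
  have hval : ∀ i, ∫ ω, Real.exp (ε i ω ^ 2 / (4 * σ ^ 2)) ∂P = √2 := fun i => by
    rw [← he, ← hmap i, integral_map (hε_meas i).aemeasurable hexp.aestronglyMeasurable]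
  have i1 : Integrable (fun ω => ∑ i : Fin n, Real.exp (ε (i + 1) ω ^ 2 / (4 * σ ^ 2))) P :=
    integrable_finsetSum _ fun i _ => hint _
  have i2 : Integrable (fun ω => 2 * B ^ 2 + 8 * σ ^ 2 * (Real.log n - 1 +
      1 / (n : ℝ) * ∑ i : Fin n, Real.exp (ε (i + 1) ω ^ 2 / (4 * σ ^ 2)))) P :=
    (integrable_const _).add (((integrable_const _).add (i1.const_mul _)).const_mul _)
  have hlog : 0 ≤ Real.log n := Real.log_natCast_nonneg n
  have hsqrt : √2 ≤ 2 := by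
    rw [Real.sqrt_le_left (by norm_num)]; norm_num
  calc ∫ ω, ‖trainY Y n ω‖ ^ 2 ∂P
      ≤ ∫ ω, (2 * B ^ 2 + 8 * σ ^ 2 * (Real.log n - 1 +
          1 / (n : ℝ) * ∑ i : Fin n, Real.exp (ε (i + 1) ω ^ 2 / (4 * σ ^ 2)))) ∂P := by
        refine integral_mono_of_nonneg (Eventually.of_forall fun ω => sq_nonneg _) i2 ?_
        filter_upwards [hB] with ω hω
        exact norm_sq_le_of_sum_exp (fun i => hY (i + 1) ω) hσ fun i => hω (i + 1)
    _ = 2 * B ^ 2 + 8 * σ ^ 2 * (Real.log n - 1 + √2) := by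
        rw [integral_add (integrable_const _) ?_, integral_const, integral_const_mul,
          integral_add (integrable_const _) (i1.const_mul _), integral_const_mul,
          integral_finsetSum _ fun i _ => hint _]
        swap
        · exact ((integrable_const _).add (i1.const_mul _)).const_mul _
        simp only [hval, integral_const, probReal_univ, one_smul, Finset.sum_const,
          Finset.card_univ, Fintype.card_fin, nsmul_eq_mul]
        have : (n : ℝ) ≠ 0 := by exact_mod_cast NeZero.ne n
        field_simp
    -- There is room to spare: `√2 ≤ 2` gives `log n - 1 + √2 ≤ 1 + 4 * log n`.
    _ ≤ _ := by nlinarith [sq_nonneg B, mul_nonneg (sq_nonneg σ) hlog,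
        mul_le_mul_of_nonneg_left hsqrt (sq_nonneg σ)]

/-- The error at a training point caused by averaging finitely many trees. -/
lemma integral_sub_oobPredict_sq_le {X : ℕ → Ω → Fin p → ℝ} {Y : ℕ → Ω → ℝ}
    (hX : ∀ i, Measurable (X i)) (hY : ∀ i, Measurable (Y i)) (hY2 : ∀ i, MemLp (Y i) 2 P)
    {θ : ℕ → Ω → TreeSeed n p a q t} (hθ : ∀ b, Measurable (θ b)) (hindep : iIndepFun θ P)
    (hlaw : ∀ b, P.map (θ b) = uniformOn Set.univ)
    (hdata : IndepFun (fun ω => (trainX X n ω, trainY Y n ω)) (fun ω b => θ b ω) P)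
    (ha : a < n) (hq : q ≤ p) {M : ℕ} (hM : 1 ≤ M) (i : Fin n) :
    ∫ ω, (trainY Y n ω i - oobPredict (trainX X n ω) (trainY Y n ω) (fun b => θ b ω) M i) ^ 2 ∂P ≤
      ∫ ω, ((trainY Y n ω i - oobMean a q t (trainX X n ω) (trainY Y n ω) i) ^ 2 +
        ‖trainY Y n ω‖ ^ 2 / M) ∂P := by
  have hD : Measurable fun ω => (trainX X n ω, trainY Y n ω) :=
    (measurable_trainX hX n).prodMk (measurable_trainY hY n)
  have hΘ : Measurable fun ω b => θ b ω := measurable_pi_lambda _ hθ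
  set μD := P.map fun ω => (trainX X n ω, trainY Y n ω)
  set ν := P.map fun ω b => θ b ω
  have hμD : IsProbabilityMeasure μD := Measure.isProbabilityMeasure_map hD.aemeasurable
  have hν : IsProbabilityMeasure ν := Measure.isProbabilityMeasure_map hΘ.aemeasurable
  let H : ((Fin n → Fin p → ℝ) × (Fin n → ℝ)) × (ℕ → TreeSeed n p a q t) → ℝ := fun u =>
    (u.1.2 i - oobPredict u.1.1 u.1.2 u.2 M i) ^ 2
  let G : (Fin n → Fin p → ℝ) × (Fin n → ℝ) → ℝ := fun d =>
    (d.2 i - oobMean a q t d.1 d.2 i) ^ 2 + ‖d.2‖ ^ 2 / M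
  have hH : Measurable H := by
    refine Measurable.pow_const (Measurable.sub ?_ (measurable_oobPredict
      (measurable_fst.comp measurable_fst) (measurable_snd.comp measurable_fst)
      measurable_snd M i)) 2
    exact (measurable_pi_apply i).comp (measurable_snd.comp measurable_fst)
  have hG : Measurable G :=
    ((((measurable_pi_apply i).comp measurable_snd).sub (measurable_oobMean measurable_fst
      measurable_snd i)).pow_const 2).add ((measurable_snd.norm.pow_const 2).div_const _)
  -- Independence of data and seeds turns conditioning on the data into Fubini for a product
  -- measure.
  have hprod : P.map (fun ω => ((trainX X n ω, trainY Y n ω), fun b => θ b ω)) = μD.prod ν :=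
    (indepFun_iff_map_prod_eq_prod_map_map hD.aemeasurable hΘ.aemeasurable).1 hdata
  have hYn := (memLp_norm_trainY hY2 hY n).integrable_sq
  have hsub : ∀ (y : Fin n → ℝ) (c : ℝ), |c| ≤ ‖y‖ → (y i - c) ^ 2 ≤ 4 * ‖y‖ ^ 2 := by
    intro y c hc
    have h3 : |y i| ≤ ‖y‖ := norm_le_pi_norm y i
    have h2 : |y i - c| ≤ 2 * ‖y‖ := (abs_sub _ _).trans (by linarith)
    have := sq_le_sq' (abs_le.1 h2).1 (abs_le.1 h2).2
    linarith
  have iH : Integrable (fun ω => H ((trainX X n ω, trainY Y n ω), fun b => θ b ω)) P := by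
    refine (hYn.const_mul 4).mono' (hH.comp (hD.prodMk hΘ)).aestronglyMeasurable
      (Eventually.of_forall fun ω => ?_)
    rw [Real.norm_of_nonneg (sq_nonneg _)]
    exact hsub _ _ (abs_oobPredict_le _ _ _ _ _)
  have iG : Integrable (fun ω => G (trainX X n ω, trainY Y n ω)) P := by
    refine Integrable.add ((hYn.const_mul 4).mono' ?_ (Eventually.of_forall fun ω => ?_))
      (hYn.div_const _)
    · exact (((measurable_pi_apply i).comp (measurable_trainY hY n)).sub (measurable_oobMean
        (measurable_trainX hX n) (measurable_trainY hY n) i)).pow_const 2 |>.aestronglyMeasurable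
    · rw [Real.norm_of_nonneg (sq_nonneg _)]
      exact hsub _ _ (abs_oobMean_le _ _ _)
  have iH' : Integrable H (μD.prod ν) := by
    rw [← hprod]
    exact (integrable_map_measure hH.aestronglyMeasurable
      (hD.prodMk hΘ).aemeasurable).2 iH
  have iG' : Integrable G μD :=
    (integrable_map_measure hG.aestronglyMeasurable hD.aemeasurable).2 iG
  change ∫ ω, H ((trainX X n ω, trainY Y n ω), fun b => θ b ω) ∂P ≤
    ∫ ω, G (trainX X n ω, trainY Y n ω) ∂P
  rw [← integral_map (f := H) (hD.prodMk hΘ).aemeasurable hH.aestronglyMeasurable, hprod,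
    integral_prod _ iH', ← integral_map (f := G) hD.aemeasurable hG.aestronglyMeasurable]
  refine integral_mono iH'.integral_prod_left iG' fun d => ?_
  dsimp only
  rw [integral_map (f := fun u => H (d, u)) hΘ.aemeasurable
    (hH.comp measurable_prodMk_left).aestronglyMeasurable]
  -- For frozen data the out-of-bag prediction is by definition a `selectedAvg` over seeds avoiding
  -- `i`, with tree predictions bounded by `K = ‖d.2‖`.
  exact integral_sub_selectedAvg_sq_le (fun s : TreeSeed n p a q t => i ∉ s.bag.1)
    (fun s => treePredict d.1 d.2 s (d.1 i)) M hθ hindep hlaw (exists_seed_notMem_bag ha hq i)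
    (norm_nonneg d.2) (fun s => abs_treePredict_le _ _ _ _) (by omega) (d.2 i)

end Gaussian

end RandomForest

end

/-! ### Assembly of the theorem -/

open RandomForest in
theorem theorem1 {Ω : Type*} [MeasurableSpace Ω] (P : Measure Ω) [IsProbabilityMeasure P]
    -- the regression model; the observation with index `0` is the unseen one
    (p : ℕ) (X : ℕ → Ω → Fin p → ℝ) (ε Y : ℕ → Ω → ℝ) (m : (Fin p → ℝ) → ℝ) (σ : ℝ)
    (hm : Measurable m)
    (hX_meas : ∀ i, Measurable (X i)) (hX_indep : iIndepFun X P)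
    (hX_ident : ∀ i, IdentDistrib (X i) (X 0) P P)
    (hε_meas : ∀ i, Measurable (ε i)) (hε_indep : iIndepFun ε P)
    (hε_ident : ∀ i, IdentDistrib (ε i) (ε 0) P P)
    (hε_sq : MemLp (ε 0) 2 P) (hε_mean : ∫ ω, ε 0 ω ∂P = 0)
    (hσ : 0 < σ) (hε_var : Var[ε 0; P] = σ ^ 2)
    (hXε : IndepFun (fun ω i => X i ω) (fun ω i => ε i ω) P)
    (hY : ∀ i ω, Y i ω = m (X i ω) + ε i ω)
    -- the tuning parameters: bag sizes `a n`, bounds `t n` on the number of leaves, `q = m_try`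
    (a t : ℕ → ℕ) (q : ℕ) (hq : 1 ≤ q ∧ q ≤ p) (ht : ∀ n, 1 ≤ t n)
    (ha : ∀ n ≥ 2, 1 ≤ a n ∧ a n < n)
    (ha_frac : ∃ γ : ℝ, γ < 1 ∧ ∀ᶠ n : ℕ in atTop, (a n : ℝ) ≤ γ * n)
    -- the seeds of the trees: i.i.d. uniform, and independent of the observations
    (Θ : (n : ℕ) → ℕ → Ω → TreeSeed n p (a n) q (t n))
    (hΘ_meas : ∀ n b, Measurable (Θ n b)) (hΘ_indep : ∀ n ≥ 2, iIndepFun (Θ n) P)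
    (hΘ_law : ∀ n ≥ 2, ∀ b, P.map (Θ n b) = uniformOn Set.univ)
    (hΘ_data : ∀ n ≥ 2,
      IndepFun (fun ω b => Θ n b ω) (fun ω i => (X i ω, ε i ω)) P)
    -- the support of the covariates is the unit cube, on which `m` is bounded
    (hX_supp : (P.map (X 0)).support = Set.Icc 0 1)
    (hm_bdd : BddAbove ((fun x => |m x|) '' Set.Icc 0 1))
    -- the infinite forest is `L₂`-consistent
    (h_consistent : Tendsto (fun n => ∫ ω, (forestPredictInf (trainX X n ω) (trainY Y n ω)
      (fun b => Θ n b ω) (X 0 ω) - m (X 0 ω)) ^ 2 ∂P) atTop (𝓝 0)) :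
    -- consistency
    (SeqL1Consistent P (fun n M ω => residualVar (trainY Y n ω)
        (oobPredict (trainX X n ω) (trainY Y n ω) (fun b => Θ n b ω) M)) (σ ^ 2) ∧
      SeqL1Consistent P (fun n M ω => residualVar (trainY Y n ω)
        (oobPredictEnsemble (trainX X n ω) (trainY Y n ω) (fun b => Θ n b ω) M)) (σ ^ 2)) ∧
    (P.map (ε 0) = gaussianReal 0 (Real.toNNReal (σ ^ 2)) →
      -- bound on the finite-`M` bias
      (∀ n ≥ 2, ∀ M ≥ 1,
        Integrable (fun ω => residualVar (trainY Y n ω)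
          (oobPredict (trainX X n ω) (trainY Y n ω) (fun b => Θ n b ω) M)) P ∧
        Integrable (fun ω => residualVar (trainY Y n ω)
          (oobPredictInf (trainX X n ω) (trainY Y n ω) (fun b => Θ n b ω))) P ∧
        ∫ ω, (residualVar (trainY Y n ω)
            (oobPredict (trainX X n ω) (trainY Y n ω) (fun b => Θ n b ω) M)
          - residualVar (trainY Y n ω)
            (oobPredictInf (trainX X n ω) (trainY Y n ω) (fun b => Θ n b ω))) ∂P
          ≤ (8 / (M : ℝ)) * ((sSup ((fun x => |m x|) '' Set.Icc 0 1)) ^ 2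
            + σ ^ 2 * (1 + 4 * Real.log n))) ∧
      -- consistency of the corrected estimator
      SeqL1Consistent P (fun n M ω => residualVarCorrected M (trainY Y n ω)
        (oobPredict (trainX X n ω) (trainY Y n ω) (fun b => Θ n b ω) M)) (σ ^ 2) ∧
      SeqL1Consistent P (fun n M ω => residualVarCorrected M (trainY Y n ω)
        (oobPredictEnsemble (trainX X n ω) (trainY Y n ω) (fun b => Θ n b ω) M)) (σ ^ 2)) := by
  have hY_meas : ∀ i, Measurable (Y i) := fun i => by
    rw [funext (hY i)]
    exact (hm.comp (hX_meas i)).add (hε_meas i)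
  set B := sSup ((fun x => |m x|) '' Set.Icc 0 1) with hBdef
  -- The support is conull, so almost surely all covariates lie in the cube, where `|m|` is at most
  -- its supremum `B`.
  have hB : ∀ᵐ ω ∂P, ∀ i, |m (X i ω)| ≤ B := by
    refine ae_all_iff.2 fun i => ?_
    have h1 : ∀ᵐ x ∂P.map (X i), x ∈ Set.Icc (0 : Fin p → ℝ) 1 := by
      rw [(hX_ident i).map_eq, ← hX_supp]
      exact Measure.support_mem_ae
    filter_upwards [ae_of_ae_map (hX_meas i).aemeasurable h1] with ω hω
    exact le_csSup hm_bdd ⟨_, hω, rfl⟩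
  have hm2 : ∀ i, MemLp (fun ω => m (X i ω)) 2 P := fun i =>
    MemLp.of_bound (hm.comp (hX_meas i)).aestronglyMeasurable B (hB.mono fun ω hω => hω i)
  have hε2 : ∀ i, MemLp (ε i) 2 P := fun i => (hε_ident i).memLp_iff.2 hε_sq
  have hY2 : ∀ i, MemLp (Y i) 2 P := fun i => by
    rw [funext (hY i)]
    exact (hm2 i).add (hε2 i)
  have hφ : Measurable fun z : (Fin p → ℝ) × ℝ => (z.1, m z.1 + z.2) :=
    measurable_fst.prodMk ((hm.comp measurable_fst).add measurable_snd)
  have hindep : iIndepFun (fun i ω => (X i ω, Y i ω)) P := by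
    have h := (iIndepFun_prodMk_of_indepFun hX_meas hε_meas hX_indep hε_indep hXε).comp
      (fun _ z => (z.1, m z.1 + z.2)) fun _ => hφ
    simpa only [hY] using! h
  have hXε' : ∀ i, IndepFun (X i) (ε i) P := fun i => by
    have h1 : Measurable fun w : ℕ → Fin p → ℝ => w i := measurable_pi_apply i
    have h2 : Measurable fun w : ℕ → ℝ => w i := measurable_pi_apply i
    exact hXε.comp h1 h2
  have hident : ∀ i, IdentDistrib (fun ω => (X i ω, Y i ω)) (fun ω => (X 0 ω, Y 0 ω)) P P := by
    intro i
    have h : IdentDistrib (fun ω => (X i ω, ε i ω)) (fun ω => (X 0 ω, ε 0 ω)) P P :=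
      (hX_ident i).prodMk (hε_ident i) (hXε' i) (hXε' 0)
    simpa only [hY] using! h.comp hφ
  have hvar : ∫ ω, ε 0 ω ^ 2 ∂P = σ ^ 2 := by
    rw [← hε_var, variance_of_integral_eq_zero (hε_meas 0).aemeasurable hε_mean]
  have hdata : ∀ n ≥ 2, IndepFun (fun ω => (trainX X n ω, trainY Y n ω))
      (fun ω b => Θ n b ω) P := by
    intro n hn
    have hψ : Measurable fun w : ℕ → (Fin p → ℝ) × ℝ =>
        ((fun j : Fin n => (w (j + 1)).1), fun j : Fin n => m (w (j + 1)).1 + (w (j + 1)).2) := by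
      refine Measurable.prodMk (measurable_pi_lambda _ fun j => ?_)
        (measurable_pi_lambda _ fun j => ?_)
      · exact measurable_fst.comp (measurable_pi_apply _)
      · exact (hm.comp (measurable_fst.comp (measurable_pi_apply _))).add
          (measurable_snd.comp (measurable_pi_apply _))
    have h := (hΘ_data n hn).symm.comp hψ measurable_id
    have e : (fun ω => (trainX X n ω, trainY Y n ω)) = (fun w : ℕ → (Fin p → ℝ) × ℝ =>
        ((fun j : Fin n => (w (j + 1)).1), fun j : Fin n => m (w (j + 1)).1 + (w (j + 1)).2)) ∘
          fun ω i => (X i ω, ε i ω) := by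
      ext1 ω
      exact Prod.ext rfl (funext fun j => hY (j + 1) ω)
    rw [e]
    exact h
  have hequi : ∀ n ≥ 2, ∀ᵐ ω ∂P, Equidistributed fun b => Θ n b ω := fun n hn =>
    ae_equidistributed (hΘ_meas n) (hΘ_indep n hn) (hΘ_law n hn)
  have htX := fun n => measurable_trainX hX_meas n
  have htY := fun n => measurable_trainY hY_meas n
  have hΘm : ∀ n, Measurable fun ω b => Θ n b ω := fun n => measurable_pi_lambda _ (hΘ_meas n)
  have hnorm : ∀ n, Integrable (fun ω => ‖trainY Y n ω‖ ^ 2) P := fun n =>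
    (memLp_norm_trainY hY2 hY_meas n).integrable_sq
  -- The version of the infinite out-of-bag prediction depending on the data only; it agrees with
  -- `oobPredictInf` almost surely, which is all that is needed.
  set O : (n : ℕ) → Ω → Fin n → ℝ := fun n ω i =>
    oobMean (a n) q (t n) (trainX X n ω) (trainY Y n ω) i with hO
  have hOm : ∀ n i, Measurable fun ω => O n ω i := fun n i =>
    measurable_oobMean (htX n) (htY n) i
  have hO2 : ∀ n i, MemLp (fun ω => O n ω i) 2 P := fun n i =>
    (memLp_norm_trainY hY2 hY_meas n).mono (hOm n i).aestronglyMeasurable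
      (Eventually.of_forall fun ω => by
        rw [norm_norm]
        exact abs_oobMean_le _ _ _)
  have hrisk : Tendsto (fun n : ℕ => 1 / (n : ℝ) *
      ∑ i : Fin n, ∫ ω, (m (X (i + 1) ω) - O n ω i) ^ 2 ∂P) atTop (𝓝 0) := by
    obtain ⟨γ, hγ, hγa⟩ := ha_frac
    -- From `a n ≤ γ * n` one gets `n / (n - a n) ≤ 1 / (1 - γ)`, so the comparison loses only a
    -- constant factor.
    have hlim := h_consistent.const_mul (1 / (1 - γ))
    rw [mul_zero] at hlim
    refine squeeze_zero' (Eventually.of_forall fun n => mul_nonneg (by positivity)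
      (Finset.sum_nonneg fun i _ => integral_nonneg fun ω => sq_nonneg _)) ?_ hlim
    filter_upwards [hγa, eventually_ge_atTop 2] with n hn hn2
    have e1 : ∫ ω, (forestPredictInf (trainX X n ω) (trainY Y n ω)
        (fun b => Θ n b ω) (X 0 ω) - m (X 0 ω)) ^ 2 ∂P =
        ∫ ω, (meanPredict (a n) q (t n) (trainX X n ω) (trainY Y n ω) (X 0 ω) -
          m (X 0 ω)) ^ 2 ∂P := by
      refine integral_congr_ae ?_
      filter_upwards [hequi n hn2] with ω hω
      rw [hω.forestPredictInf_eq]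
    have h := sum_integral_oobMean_sub_sq_le (q := q) (t := t n) hX_meas hY_meas hm hindep hident
      hY2 (hm2 0) (ha n hn2).2
    rw [e1]
    simp only [sub_sq_comm (m _), hO]
    have hn0 : (0 : ℝ) < n := by positivity
    have hna : (0 : ℝ) < n - a n := sub_pos.2 (by exact_mod_cast (ha n hn2).2)
    refine (mul_le_mul_of_nonneg_left h (by positivity)).trans ?_
    rw [← mul_assoc]
    refine mul_le_mul_of_nonneg_right ?_ (integral_nonneg fun ω => sq_nonneg _)
    have e2 : 1 / (n : ℝ) * ((n : ℝ) ^ 2 / (n - a n)) = n / (n - a n) := by field_simp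
    rw [e2, div_le_div_iff₀ hna (sub_pos.2 hγ)]
    linarith
  have hV := tendsto_integral_abs_residualVar_sub (Y := Y) (pred := O)
    (r := fun n ω i => m (X (i + 1) ω) - O n ω i) hε_indep hε_ident hε_sq hvar
    (fun n ω i => by simp only [trainY, hY]; ring)
    (fun n i => (hm2 (i + 1)).sub (hO2 n i)) hrisk
  have hlim1 : ∀ n ≥ 2, ∀ᵐ ω ∂P, ∀ i, Tendsto (fun M => oobPredict (trainX X n ω) (trainY Y n ω)
      (fun b => Θ n b ω) M i) atTop (𝓝 (O n ω i)) := by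
    intro n hn
    filter_upwards [hequi n hn] with ω hω i
    exact hω.tendsto_oobPredict (ha n hn).2 hq.2 _ _ i
  have hlim2 : ∀ n ≥ 2, ∀ᵐ ω ∂P, ∀ i, Tendsto (fun M => oobPredictEnsemble (trainX X n ω)
      (trainY Y n ω) (fun b => Θ n b ω) M i) atTop (𝓝 (O n ω i)) := by
    intro n hn
    filter_upwards [hequi n hn] with ω hω i
    exact hω.tendsto_oobPredictEnsemble (ha n hn).2 hq.2 _ _ i
  -- Only measurability, the bound by `‖trainY‖` and the common limit `O` matter, so both ways of
  -- counting the out-of-bag trees are handled at once.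
  have hplain : ∀ pred : (n : ℕ) → ℕ → Ω → Fin n → ℝ,
      (∀ n M i, Measurable fun ω => pred n M ω i) →
      (∀ n M ω i, |pred n M ω i| ≤ ‖trainY Y n ω‖) →
      (∀ n ≥ 2, ∀ᵐ ω ∂P, ∀ i, Tendsto (fun M => pred n M ω i) atTop (𝓝 (O n ω i))) →
      SeqL1Consistent P (fun n M ω => residualVar (trainY Y n ω) (pred n M ω)) (σ ^ 2) := by
    intro pred hpm hpb hpl
    refine seqL1Consistent_of_dominated (g := fun n ω => 4 * ‖trainY Y n ω‖ ^ 2)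
      (fun n _ M _ => (measurable_residualVar (htY n) (hpm n M)).aestronglyMeasurable)
      (fun n _ => (hnorm n).const_mul 4) (fun n _ M _ ω => ?_)
      (fun n hn => (hpl n hn).mono fun ω hω => tendsto_residualVar hω) hV
    rw [abs_of_nonneg (residualVar_nonneg _ _)]
    exact residualVar_le (hpb n M ω)
  have hcorrected : ∀ pred : (n : ℕ) → ℕ → Ω → Fin n → ℝ,
      (∀ n M i, Measurable fun ω => pred n M ω i) →
      (∀ n M ω i, |pred n M ω i| ≤ ‖trainY Y n ω‖) →
      (∀ n ≥ 2, ∀ᵐ ω ∂P, ∀ i, Tendsto (fun M => pred n M ω i) atTop (𝓝 (O n ω i))) →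
      SeqL1Consistent P (fun n M ω => residualVarCorrected M (trainY Y n ω) (pred n M ω))
        (σ ^ 2) := by
    intro pred hpm hpb hpl
    have hne : ∀ n ≥ 2, NeZero n := fun n hn => ⟨by omega⟩
    refine seqL1Consistent_of_dominated
      (g := fun n ω => (44 + 128 * Real.log n) * ‖trainY Y n ω‖ ^ 2)
      (fun n hn M _ => ?_) (fun n _ => (hnorm n).const_mul _) (fun n hn M hM ω => ?_)
      (fun n hn => ?_) hV
    · have := hne n hn
      exact (measurable_residualVarCorrected M (htY n) (hpm n M)).aestronglyMeasurable
    · have := hne n hn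
      exact abs_residualVarCorrected_le hM (hpb n M ω)
    · have := hne n hn
      exact (hpl n hn).mono fun ω hω => tendsto_residualVarCorrected hω
  have hm_oob : ∀ n M i, Measurable fun ω => oobPredict (trainX X n ω) (trainY Y n ω)
      (fun b => Θ n b ω) M i := fun n M i => measurable_oobPredict (htX n) (htY n) (hΘm n) M i
  have hm_ens : ∀ n M i, Measurable fun ω => oobPredictEnsemble (trainX X n ω) (trainY Y n ω)
      (fun b => Θ n b ω) M i := fun n M i =>
    measurable_oobPredictEnsemble (htX n) (htY n) (hΘm n) M i
  have hcons := hplain (fun n M ω => oobPredict (trainX X n ω) (trainY Y n ω)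
    (fun b => Θ n b ω) M) hm_oob (fun n M ω i => abs_oobPredict_le _ _ _ _ _) hlim1
  refine ⟨⟨hcons, hplain _ hm_ens (fun n M ω i => abs_oobPredictEnsemble_le _ _ _ _ _) hlim2⟩,
    fun hgauss => ⟨fun n hn M hM => ?_,
      hcorrected _ hm_oob (fun n M ω i => abs_oobPredict_le _ _ _ _ _) hlim1,
      hcorrected _ hm_ens (fun n M ω i => abs_oobPredictEnsemble_le _ _ _ _ _) hlim2⟩⟩
  have hintM := hcons.1 n hn M hM
  have hintO : Integrable (fun ω => residualVar (trainY Y n ω) (O n ω)) P := by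
    refine ((hnorm n).const_mul 4).mono'
      (measurable_residualVar (htY n) (hOm n)).aestronglyMeasurable
      (Eventually.of_forall fun ω => ?_)
    rw [Real.norm_of_nonneg (residualVar_nonneg _ _)]
    exact residualVar_le fun i => abs_oobMean_le _ _ _
  have hae : ∀ᵐ ω ∂P, residualVar (trainY Y n ω) (oobPredictInf (trainX X n ω) (trainY Y n ω)
      (fun b => Θ n b ω)) = residualVar (trainY Y n ω) (O n ω) := by
    filter_upwards [hequi n hn] with ω hω
    congr 1
    ext1 i
    exact hω.oobPredictInf_eq (ha n hn).2 hq.2 _ _ i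
  have hintInf := hintO.congr (hae.mono fun ω hω => hω.symm)
  refine ⟨hintM, hintInf, ?_⟩
  have hsqint : ∀ (f : Ω → Fin n → ℝ), (∀ i, Measurable fun ω => f ω i) →
      (∀ ω i, |f ω i| ≤ ‖trainY Y n ω‖) → ∀ i,
        Integrable (fun ω => (trainY Y n ω i - f ω i) ^ 2) P := by
    intro f hfm hfb i
    refine MemLp.integrable_sq (f := fun ω => trainY Y n ω i - f ω i) ((hY2 (i + 1)).sub ?_)
    exact (memLp_norm_trainY hY2 hY_meas n).mono (hfm i).aestronglyMeasurable
      (Eventually.of_forall fun ω => by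
        rw [norm_norm]
        exact hfb ω i)
  have i1 := hsqint _ (hm_oob n M) fun ω i => abs_oobPredict_le _ _ _ _ _
  have i2 := hsqint _ (hOm n) fun ω i => abs_oobMean_le _ _ _
  have hstep := fun i => integral_sub_oobPredict_sq_le hX_meas hY_meas hY2 (hΘ_meas n)
    (hΘ_indep n hn) (hΘ_law n hn) (hdata n hn) (ha n hn).2 hq.2 hM i
  have hnormY := integral_norm_trainY_sq_le (n := n) hσ hε_meas hε_ident hgauss hY hB hn
  have hMpos : (0 : ℝ) < M := by exact_mod_cast hM
  have hn0 : (n : ℝ) ≠ 0 := by positivity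
  -- Each training point contributes an excess of at most `E‖Y‖ ^ 2 / M`; the `n` of them are offset
  -- by the factor `1 / n` in the estimator.
  have hsum : ∑ i : Fin n, ∫ ω, (trainY Y n ω i - oobPredict (trainX X n ω) (trainY Y n ω)
      (fun b => Θ n b ω) M i) ^ 2 ∂P ≤
        ∑ i : Fin n, ∫ ω, (trainY Y n ω i - O n ω i) ^ 2 ∂P +
          n * ((∫ ω, ‖trainY Y n ω‖ ^ 2 ∂P) / M) := by
    refine (Finset.sum_le_sum fun i _ => hstep i).trans (le_of_eq ?_)
    have e : ∀ i : Fin n, ∫ ω, ((trainY Y n ω i - oobMean (a n) q (t n) (trainX X n ω)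
        (trainY Y n ω) i) ^ 2 + ‖trainY Y n ω‖ ^ 2 / M) ∂P =
          ∫ ω, (trainY Y n ω i - O n ω i) ^ 2 ∂P + (∫ ω, ‖trainY Y n ω‖ ^ 2 ∂P) / M :=
      fun i => by rw [integral_add (i2 i) ((hnorm n).div_const _), integral_div]
    simp only [e, Finset.sum_add_distrib, Finset.sum_const, Finset.card_univ, Fintype.card_fin,
      nsmul_eq_mul]
  rw [integral_sub hintM hintInf, integral_congr_ae hae]
  simp only [residualVar]
  rw [integral_const_mul, integral_const_mul, integral_finsetSum _ fun i _ => i1 i,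
    integral_finsetSum _ fun i _ => i2 i, ← mul_sub]
  calc 1 / (n : ℝ) * _ ≤ 1 / (n : ℝ) * (n * ((∫ ω, ‖trainY Y n ω‖ ^ 2 ∂P) / M)) := by
        refine mul_le_mul_of_nonneg_left ?_ (by positivity)
        linarith
    _ = (∫ ω, ‖trainY Y n ω‖ ^ 2 ∂P) / M := by field_simp
    _ ≤ 8 * (B ^ 2 + σ ^ 2 * (1 + 4 * Real.log n)) / M := by gcongr
    _ = 8 / (M : ℝ) * (B ^ 2 + σ ^ 2 * (1 + 4 * Real.log n)) := by ring
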